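/- Let $M$ be a matroid on a finite set $E=\{e_1,\dots,e_n\}$ that is realizable over $\mathbb C$, i.e. there are vectors $f(e)$ $(e\in E)$ in a finite-dimensional complex vector space such that $I\subseteq E$ is independent in $M$ if and only if $(f(e))_{e\in I}$ is linearly independent. \emph{The Whitney module.} Let $A$ be the exterior algebra over $\mathbb Z$ on the set of symbols $(e|p_i)$, $e\in E$, $i=1,2,3,\dots$. For a word $w=a_1a_2\cdots a_k$ in $E$ and a sequence $\alpha=(\alpha_1,\alpha_2,\dots)$ of non-negative integers with $\sum_i\alpha_i=k$, let $$(w|p^{(\alpha)})=\sum_{c}(a_1|p_{c_1})(a_2|p_{c_2})\cdots(a_k|p_{c_k})\in A,$$ the sum being over all words $c=c_1\cdots c_k$ in which each $i$ occurs exactly $\alpha_i$ times (this is the Laplace pairing of $w$ with $p^{(\alpha)}=p_1^{(\alpha_1)}p_2^{(\alpha_2)}\cdots$). The Whitney module $W(M)$ is the quotient of $A$ by the two-sided ideal generated by all $(w|p^{(\alpha)})$ for which the letters of $w$ form a dependent set of $M$. The doubly multilinear submodule $U(M)\subseteq W(M)$ is the $\mathbb Z$-span of the elements $(e_1|p_{\sigma(1)})(e_2|p_{\sigma(2)})\cdots(e_n|p_{\sigma(n)})$,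 $\sigma\in\mathfrak S_n$. The group $\mathfrak S_n$ acts on the right of $U(M)$, and of $\mathbb C\otimes U(M)$, by place permutation: $$\bigl((a_1|p_1)(a_2|p_2)\cdots(a_n|p_n)\bigr)\cdot\sigma=(a_{\sigma(1)}|p_1)(a_{\sigma(2)}|p_2)\cdots(a_{\sigma(n)}|p_n)$$ for every ordering $a_1,\dots,a_n$ of $E$; equivalently, $\sigma$ acts as $\operatorname{sign}(\sigma)$ times the substitution $p_i\mapsto p_{\sigma^{-1}(i)}$. \emph{Irreducibles.} For a partition $\lambda$ of $n$ and a tableau $T$ of shape $\lambda$ in which each of $1,\dots,n$ occurs once, let $$c_T=\Bigl(\sum_{\sigma\in R_T}\operatorname{sign}(\sigma)\,\sigma\Bigr)\Bigl(\sum_{\tau\in C_T}\tau\Bigr)\in\mathbb C\mathfrak S_n,$$ where $R_T$ and $C_T$ are the subgroups of $\mathfrak S_n$ that preserve the rows and the columns of $T$. (So $(n)$ corresponds to the sign representation.) The partition $\lambda$ \emph{appears} in a right $\mathbb C\mathfrak S_n$-module if that module has a submodule isomorphic to the right ideal $c_T\,\mathbb C\mathfrak S_n$. \emph{Rank partition.}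 Let $\rho(M)=(\rho_1,\rho_2,\dots)$ be determined by the condition that, for all $k$, $\rho_1+\dots+\rho_k$ is the largest size of a union of $k$ independent sets of $M$. \textbf{Corollary.} For every partition $\lambda$ of $n$ (and every such tableau $T$ of shape $\lambda$), $\lambda$ appears in $\mathbb C\otimes U(M)$ if and only if $\lambda\le\rho(M)$ in dominance order, i.e. $\lambda_1+\dots+\lambda_k\le\rho_1+\dots+\rho_k$ for all $k$. -/

import Mathlib

noncomputable section

namespace Whitney

/-! ### The letter-place algebra -/

/-- The letter-place algebra `Super(L⁻|P⁺)` with negative letters `E` and positive places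
`p₁, p₂, …` (indexed from `0`): the exterior algebra of the free `ℤ`-module on the letter-place
pairs `(e|p)`. -/
abbrev LetterPlace (E : Type*) : Type _ := ExteriorAlgebra ℤ ((E × ℕ) →₀ ℤ)

/-- The letter-place pair `(e|p)`, as a basis vector of the free module. -/
def pair {E : Type*} (e : E) (p : ℕ) : (E × ℕ) →₀ ℤ := Finsupp.single (e, p) 1

/-- The pairing `(e|p^(β))` of one letter with a monomial in the divided powers: it is `(e|p)` if
`p^(β)` is the single place `p`, and `0` if `p^(β)` does not have degree `1`. -/
def laplaceLetter {E : Type*} (e : E) (β : ℕ →₀ ℕ) : LetterPlace E :=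
  if β.degree = 1 then ∑ p ∈ β.support, ExteriorAlgebra.ι ℤ (pair e p) else 0

/-- The Laplace pairing `(w|p^(α))` of a word `w = e₁ e₂ ⋯ e_k` with the monomial
`p^(α) = p₁^(α₁) p₂^(α₂) ⋯` in the divided powers. It is computed by the rules
`(1|1) = 1`, `(w|q) = 0` if the degrees of `w` and `q` differ, and
`(w w'|q) = ∑ (w|q₁)(w'|q₂)` summed over the coproduct of `q`, where the coproduct of `p^(α)` is
`∑_{β + γ = α} p^(β) ⊗ p^(γ)`. -/
def laplace {E : Type*} : List E → (ℕ →₀ ℕ) → LetterPlace E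
  | [], α => if α = 0 then 1 else 0
  | e :: w, α => ∑ x ∈ Finset.HasAntidiagonal.antidiagonal α, laplaceLetter e x.1 * laplace w x.2

/-! ### The Whitney module -/

/-- The relations of the Whitney module: `(w|p^(α)) = 0` for every dependent word `w` and every
composition `α` of `|w|` (zero parts are allowed). -/
inductive WhitneyRel {E : Type*} (M : Matroid E) : LetterPlace E → LetterPlace E → Prop
  | dep (w : List E) (α : ℕ →₀ ℕ) (hw : M.Dep {e | e ∈ w}) (hα : α.degree = w.length) :
      WhitneyRel M (laplace w α) 0

/-- The Whitney module `W(M)`: the quotient of the letter-place algebra by the two-sided ideal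
generated by the elements `(w|p^(α))`, `w` a dependent word. -/
abbrev WhitneyModule {E : Type*} (M : Matroid E) : Type _ := RingQuot (WhitneyRel M)

/-- The quotient map onto the Whitney module. -/
def toWhitney {E : Type*} (M : Matroid E) : LetterPlace E →ₐ[ℤ] WhitneyModule M :=
  RingQuot.mkAlgHom ℤ (WhitneyRel M)

/-- The product `(a₁|p_{c₁}) (a₂|p_{c₂}) ⋯ (a_n|p_{c_n})` in `W(M)`. -/
def monomial {E : Type*} (M : Matroid E) {n : ℕ} (a : Fin n → E) (c : Fin n → ℕ) :
    WhitneyModule M :=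
  toWhitney M (ExteriorAlgebra.ιMulti ℤ n fun i => pair (a i) (c i))

/-- The doubly multilinear submodule `U(M)`: the `ℤ`-span in `W(M)` of the elements
`(e₁|p_{σ(1)}) (e₂|p_{σ(2)}) ⋯ (e_n|p_{σ(n)})`, `σ` a permutation; here `e₁, …, e_n` is the given
list of the elements of `E`. -/
def doublyMultilinear {E : Type*} (M : Matroid E) {n : ℕ} (e : Fin n ≃ E) :
    Submodule ℤ (WhitneyModule M) :=
  Submodule.span ℤ (Set.range fun σ : Equiv.Perm (Fin n) => monomial M e fun i => (σ i : ℕ))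

/-! ### The action of the symmetric group -/

/-- Substitution of places `(e|p) ↦ (e|π p)` on the letter-place algebra. -/
def substPlaces (E : Type*) (π : Equiv.Perm ℕ) : LetterPlace E →ₐ[ℤ] LetterPlace E :=
  ExteriorAlgebra.map (Finsupp.lmapDomain ℤ ℤ (Prod.map id π))

theorem lmapDomain_pair {E : Type*} (π : Equiv.Perm ℕ) (e : E) (p : ℕ) :
    Finsupp.lmapDomain ℤ ℤ (Prod.map id π) (pair e p) = pair e (π p) := by
  simp [pair, Finsupp.mapDomain_single]

theorem substPlaces_laplaceLetter {E : Type*} (π : Equiv.Perm ℕ) (e : E) (β : ℕ →₀ ℕ) :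
    substPlaces E π (laplaceLetter e β) = laplaceLetter e (β.mapDomain π) := by
  classical
  unfold laplaceLetter
  rw [Finsupp.degree_mapDomain]
  split_ifs
  · rw [map_sum, Finsupp.mapDomain_support_of_injective π.injective,
      Finset.sum_image fun a _ b _ h => π.injective h]
    refine Finset.sum_congr rfl fun p _ => ?_
    rw [substPlaces, ExteriorAlgebra.map_apply_ι, lmapDomain_pair]
  · simp

theorem substPlaces_laplace {E : Type*} (π : Equiv.Perm ℕ) (w : List E) (α : ℕ →₀ ℕ) :
    substPlaces E π (laplace w α) = laplace w (α.mapDomain π) := by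
  classical
  have hinj := Finsupp.mapDomain_injective (M := ℕ) π.injective
  induction w generalizing α with
  | nil =>
    have h0 : α.mapDomain π = 0 ↔ α = 0 := by
      simpa using hinj.eq_iff (a := α) (b := 0)
    by_cases h : α = 0 <;> simp [laplace, h, h0]
  | cons e w ih =>
    simp only [laplace, map_sum, map_mul, substPlaces_laplaceLetter, ih]
    refine Finset.sum_bij' (fun x _ => (x.1.mapDomain π, x.2.mapDomain π))
      (fun x _ => (x.1.mapDomain π.symm, x.2.mapDomain π.symm)) ?_ ?_ ?_ ?_ ?_
    · intro x hx
      rw [Finset.HasAntidiagonal.mem_antidiagonal] at hx ⊢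
      rw [← Finsupp.mapDomain_add, hx]
    · intro x hx
      rw [Finset.HasAntidiagonal.mem_antidiagonal] at hx ⊢
      rw [← Finsupp.mapDomain_add, hx, ← Finsupp.mapDomain_comp]
      simp
    · intro x _
      simp [← Finsupp.mapDomain_comp]
    · intro x _
      simp [← Finsupp.mapDomain_comp]
    · intro x _
      rfl

/-- Substitution of places `(e|p) ↦ (e|π p)` on the Whitney module. -/
def permPlaces {E : Type*} (M : Matroid E) (π : Equiv.Perm ℕ) :
    WhitneyModule M →ₐ[ℤ] WhitneyModule M :=
  RingQuot.liftAlgHom ℤ ⟨(toWhitney M).comp (substPlaces E π), by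
    rintro _ _ ⟨w, α, hw, hα⟩
    have h : WhitneyRel M (laplace w (α.mapDomain π)) 0 :=
      .dep w _ hw (by rw [Finsupp.degree_mapDomain, hα])
    simpa [substPlaces_laplace, toWhitney] using RingQuot.mkAlgHom_rel ℤ h⟩

theorem permPlaces_toWhitney {E : Type*} (M : Matroid E) (π : Equiv.Perm ℕ) (x : LetterPlace E) :
    permPlaces M π (toWhitney M x) = toWhitney M (substPlaces E π x) := by
  simp [permPlaces, toWhitney]

theorem permPlaces_monomial {E : Type*} (M : Matroid E) (π : Equiv.Perm ℕ) {n : ℕ}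
    (a : Fin n → E) (c : Fin n → ℕ) :
    permPlaces M π (monomial M a c) = monomial M a fun i => π (c i) := by
  rw [monomial, permPlaces_toWhitney, substPlaces, ExteriorAlgebra.map_apply_ιMulti, monomial]
  congr 2
  funext i
  exact lmapDomain_pair π _ _

theorem permPlaces_one {E : Type*} (M : Matroid E) : permPlaces M 1 = AlgHom.id ℤ _ := by
  refine AlgHom.ext fun x => ?_
  obtain ⟨y, rfl⟩ := RingQuot.mkAlgHom_surjective ℤ (WhitneyRel M) x
  change permPlaces M 1 (toWhitney M y) = toWhitney M y
  rw [permPlaces_toWhitney, substPlaces]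
  have h : Finsupp.lmapDomain ℤ ℤ (Prod.map id (1 : Equiv.Perm ℕ) : E × ℕ → E × ℕ) =
      LinearMap.id := by
    ext a
    simp
  rw [h, ExteriorAlgebra.map_id]
  rfl

theorem permPlaces_mul {E : Type*} (M : Matroid E) (π π' : Equiv.Perm ℕ) :
    permPlaces M (π * π') = (permPlaces M π).comp (permPlaces M π') := by
  refine AlgHom.ext fun x => ?_
  obtain ⟨y, rfl⟩ := RingQuot.mkAlgHom_surjective ℤ (WhitneyRel M) x
  change permPlaces M (π * π') (toWhitney M y) = permPlaces M π (permPlaces M π' (toWhitney M y))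
  rw [permPlaces_toWhitney, permPlaces_toWhitney, permPlaces_toWhitney]
  congr 1
  change _ = ((substPlaces E π).comp (substPlaces E π')) y
  rw [substPlaces, substPlaces, substPlaces, ExteriorAlgebra.map_comp_map]
  congr 2
  refine Finsupp.lhom_ext' fun a => LinearMap.ext_ring ?_
  simp [Finsupp.mapDomain_single, Prod.map]

/-- A permutation of the first `n` places, as a permutation of all places. -/
def extendPerm (n : ℕ) : Equiv.Perm (Fin n) →* Equiv.Perm ℕ :=
  Equiv.Perm.viaEmbeddingHom Fin.valEmbedding

theorem extendPerm_apply {n : ℕ} (σ : Equiv.Perm (Fin n)) (i : Fin n) :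
    extendPerm n σ i = σ i :=
  Equiv.Perm.viaEmbedding_apply σ Fin.valEmbedding i

/-- The right action of `𝔖_n` on `W(M)` by place permutation: on words in the letters it is
`(a₁|p₁) ⋯ (a_n|p_n) ↦ (a_{σ(1)}|p₁) ⋯ (a_{σ(n)}|p_n)`, see `placeRep_monomial`, like the right
action on `V^{⊗ n}`. Since the factors anticommute, this is `sign σ` times the substitution
`p_i ↦ p_{σ⁻¹(i)}`. A right action of a group is a representation of the opposite group. -/
def placeRep {E : Type*} (M : Matroid E) (n : ℕ) :
    Representation ℤ (Equiv.Perm (Fin n))ᵐᵒᵖ (WhitneyModule M) where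
  toFun g := (Equiv.Perm.sign g.unop : ℤ) • (permPlaces M (extendPerm n g.unop⁻¹)).toLinearMap
  map_one' := by
    refine LinearMap.ext fun x => ?_
    simp only [MulOpposite.unop_one, inv_one, map_one, permPlaces_one, Units.val_one, one_smul]
    rfl
  map_mul' g h := by
    refine LinearMap.ext fun x => ?_
    change _ = (Equiv.Perm.sign g.unop : ℤ) • permPlaces M (extendPerm n g.unop⁻¹)
      ((Equiv.Perm.sign h.unop : ℤ) • permPlaces M (extendPerm n h.unop⁻¹) x)
    simp only [MulOpposite.unop_mul, mul_inv_rev, map_mul, permPlaces_mul, Units.val_mul,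
      LinearMap.smul_apply, AlgHom.toLinearMap_apply, AlgHom.comp_apply, map_zsmul, smul_smul]
    rw [mul_comm]

theorem placeRep_apply {E : Type*} (M : Matroid E) (n : ℕ) (g : (Equiv.Perm (Fin n))ᵐᵒᵖ)
    (x : WhitneyModule M) :
    placeRep M n g x =
      (Equiv.Perm.sign g.unop : ℤ) • permPlaces M (extendPerm n g.unop⁻¹) x :=
  rfl

theorem placeRep_monomial {E : Type*} (M : Matroid E) {n : ℕ} (σ : Equiv.Perm (Fin n))
    (a : Fin n → E) :
    placeRep M n (MulOpposite.op σ) (monomial M a fun i => (i : ℕ)) =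
      monomial M (fun i => a (σ i)) fun i => (i : ℕ) := by
  have h := (ExteriorAlgebra.ιMulti ℤ n).map_perm
    (fun i => pair (a i) (((σ⁻¹ i : Fin n) : ℕ))) σ
  rw [placeRep_apply, permPlaces_monomial]
  simp only [MulOpposite.unop_op, extendPerm_apply]
  rw [monomial, monomial, ← map_zsmul]
  congr 1
  rw [← Units.smul_def, ← h]
  congr 1
  funext i
  simp

/-- `U(M)` is stable under place permutation. -/
def doublyMultilinearSub {E : Type*} (M : Matroid E) {n : ℕ} (e : Fin n ≃ E) :
    Subrepresentation (placeRep M n) where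
  toSubmodule := doublyMultilinear M e
  apply_mem_toSubmodule g v hv := by
    refine Submodule.span_induction (p := fun v _ => placeRep M n g v ∈ doublyMultilinear M e)
      ?_ ?_ ?_ ?_ hv
    · rintro _ ⟨σ, rfl⟩
      rw [placeRep_apply, permPlaces_monomial]
      refine Submodule.smul_mem _ _ (Submodule.subset_span ⟨g.unop⁻¹ * σ, ?_⟩)
      simp only [extendPerm_apply, Equiv.Perm.mul_apply]
    · simp
    · intro x y _ _ hx hy
      rw [map_add]
      exact Submodule.add_mem _ hx hy
    · intro a x _ hx
      rw [map_smul]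
      exact Submodule.smul_mem _ _ hx

/-- The complexified module `ℂ ⊗ U(M)` with its right action of `𝔖_n`. -/
def complexRep {E : Type*} (M : Matroid E) {n : ℕ} (e : Fin n ≃ E) :
    Representation ℂ (Equiv.Perm (Fin n))ᵐᵒᵖ (TensorProduct ℤ ℂ (doublyMultilinear M e)) :=
  (Module.End.baseChangeHom ℤ ℂ (doublyMultilinear M e)).toMonoidHom.comp
    (doublyMultilinearSub M e).toRepresentation

/-! ### Irreducible representations of the symmetric group -/

/-- A tableau of shape `lam` with content `(1, …, 1)`: each of `1, …, n` fills exactly one box. -/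
abbrev Tableau (lam : YoungDiagram) (n : ℕ) : Type := lam.cells ≃ Fin n

/-- The group `R_T` of the permutations that preserve each row of `T`. -/
def rowGroup {lam : YoungDiagram} {n : ℕ} (T : Tableau lam n) : Finset (Equiv.Perm (Fin n)) :=
  {σ | ∀ k, (T.symm (σ k)).1.1 = (T.symm k).1.1}

/-- The group `C_T` of the permutations that preserve each column of `T`. -/
def colGroup {lam : YoungDiagram} {n : ℕ} (T : Tableau lam n) : Finset (Equiv.Perm (Fin n)) :=
  {σ | ∀ k, (T.symm (σ k)).1.2 = (T.symm k).1.2}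

/-- The Young symmetrizer `c_T = (∑_{σ ∈ R_T} sign(σ) σ) (∑_{τ ∈ C_T} τ)`. -/
def youngSymmetrizer {lam : YoungDiagram} {n : ℕ} (T : Tableau lam n) :
    MonoidAlgebra ℂ (Equiv.Perm (Fin n)) :=
  (∑ σ ∈ rowGroup T, ((Equiv.Perm.sign σ : ℤ) : ℂ) • MonoidAlgebra.of ℂ _ σ) *
    ∑ τ ∈ colGroup T, MonoidAlgebra.of ℂ _ τ

/-- The right regular representation of `G` on `ℂ[G]`. -/
def rightRegular (G : Type*) [Group G] : Representation ℂ Gᵐᵒᵖ (MonoidAlgebra ℂ G) where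
  toFun g := LinearMap.mulRight ℂ (MonoidAlgebra.of ℂ G g.unop)
  map_one' := by
    ext x
    simp
  map_mul' g h := by
    ext x
    simp [mul_assoc]

/-- The right ideal `c ℂ[G]`, as a subrepresentation of the right regular representation. -/
def rightIdeal {G : Type*} [Group G] (c : MonoidAlgebra ℂ G) :
    Subrepresentation (rightRegular G) where
  toSubmodule := LinearMap.range (LinearMap.mulLeft ℂ c)
  apply_mem_toSubmodule g v hv := by
    obtain ⟨x, rfl⟩ := hv
    exact ⟨x * MonoidAlgebra.of ℂ G g.unop, by simp [rightRegular, mul_assoc]⟩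

/-- The shape of `T` appears in the right representation `ρ` of `𝔖_n`: there is a submodule that is
isomorphic to the right ideal `c_T ℂ𝔖_n`. -/
def Appears {lam : YoungDiagram} {n : ℕ} (T : Tableau lam n) {V : Type*} [AddCommGroup V]
    [Module ℂ V] (ρ : Representation ℂ (Equiv.Perm (Fin n))ᵐᵒᵖ V) : Prop :=
  ∃ N : Subrepresentation ρ,
    Nonempty ((rightIdeal (youngSymmetrizer T)).toRepresentation.Equiv N.toRepresentation)

/-! ### Matroids -/

/-- `M` is realizable over `ℂ`: its independent sets are those of a finite family of vectors in a
finite-dimensional complex vector space. -/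
def RealizableOverComplex {E : Type*} (M : Matroid E) : Prop :=
  ∃ (d : ℕ) (f : E → Fin d → ℂ), ∀ I : Set E, M.Indep I ↔ LinearIndepOn ℂ f I

/-- The largest size of a union of `k` independent sets. -/
def maxUnion {E : Type*} (M : Matroid E) (k : ℕ) : ℕ :=
  sSup {m | ∃ I : Fin k → Set E, (∀ j, M.Indep (I j)) ∧ m = (⋃ j, I j).ncard}

/-- The rank partition `ρ(M)`, indexed from `0`. It is determined by
`ρ₁ + ⋯ + ρ_k = maxUnion M k`, see `sum_rankPartition`. -/
def rankPartition {E : Type*} (M : Matroid E) (i : ℕ) : ℕ :=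
  maxUnion M (i + 1) - maxUnion M i

theorem maxUnion_zero {E : Type*} (M : Matroid E) : maxUnion M 0 = 0 := by
  simp [maxUnion]

theorem maxUnion_mono {E : Type*} [Finite E] (M : Matroid E) : Monotone (maxUnion M) := by
  refine monotone_nat_of_le_succ fun k => csSup_le ⟨0, fun _ => ∅, by simp⟩ ?_
  rintro _ ⟨I, hI, rfl⟩
  refine le_csSup ⟨Nat.card E, ?_⟩ ⟨Fin.cons ∅ I, ?_, ?_⟩
  · rintro _ ⟨J, -, rfl⟩
    exact Set.ncard_le_card _
  · intro j
    refine Fin.cases ?_ ?_ j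
    · exact M.empty_indep
    · exact hI
  · congr 1
    ext x
    simp

theorem sum_rankPartition {E : Type*} [Finite E] (M : Matroid E) (k : ℕ) :
    ∑ i ∈ Finset.range k, rankPartition M i = maxUnion M k := by
  have h := Finset.sum_range_tsub (maxUnion_mono M) k
  rw [maxUnion_zero, Nat.sub_zero] at h
  exact h

/-- Dominance `a ≤ b`: every partial sum of `a` is at most the corresponding partial sum of `b`. -/
def DominatedBy (a b : ℕ → ℕ) : Prop :=
  ∀ k, ∑ i ∈ Finset.range k, a i ≤ ∑ i ∈ Finset.range k, b i

end Whitney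

end

/-! For an ordering `a` of `E`, let `x_a` be the class of (a₁|p₁)⋯(a_n|p_n). These elements span ℂ ⊗
U(M), and 𝔖_n permutes them. Both directions compare the shape with orderings `a` for which the
entries of every row of `T` are sent to an independent set.

Necessity. If the irreducible appears, the signed row sum of `T` does not annihilate some `x_a`
(`exists_actOn_rowSum_ne_zero`). The signed sum over the permutations of one row is, after letters
are traded for places, a Laplace pairing of that row times a fixed factor, so it vanishes when the
row is dependent. As the full row sum absorbs it up to a nonzero scalar, every row is independent
(`indep_row_of_actOn_ne_zero`). The first k rows are then k independent sets with λ₁+⋯+λ_k elements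
in their union.

Sufficiency. Dominance gives the rank inequality of a Rado-type theorem, hence a partition of `E`
into independent sets of sizes λ_i (`exists_indep_partition`) and an ordering `a` with independent
rows. A realization `f` turns Laplace pairings into alternating functions of the vectors, so
dependent words are killed, and there are functionals with x_a ↦ ∏ φ_i(f(a_i))
(`exists_functional`). Let φ_i depend only on the column of i. The column sum then contributes the
factor |C_T|, and the signed row sum contributes a block diagonal determinant with one block per
row, which is nonzero for generic forms (`exists_forms_det_blocks_ne_zero`). So the Young
symmetrizer c does not annihilate `x_a`. Since the group algebra is semiprime and c·x·c is always a
multiple of c, the map h ↦ x_a·h is injective on the right ideal of c (`appears_of_actOn_ne_zero`).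
-/

noncomputable section

namespace Whitney

/-! ### Partitions of a matroid into independent sets of prescribed sizes -/

/-- A version of Rado's theorem for several submodular functions: if every element of `ι` has a
list of admissible colours and the rank inequality holds for all sets, then it still holds for a
suitable choice of one colour for each element. -/
theorem exists_colouring_of_submodular {ι κ : Type*} [Fintype ι] [DecidableEq ι] [Fintype κ]
    [DecidableEq κ] (r : κ → Finset ι → ℕ) (h0 : ∀ k, r k ∅ = 0) (hmono : ∀ k, Monotone (r k))
    (hsub : ∀ k A B, r k (A ∪ B) + r k (A ∩ B) ≤ r k A + r k B) (S : ι → Finset κ)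
    (hS : ∀ J : Finset ι, J.card ≤ ∑ k, r k {x ∈ J | k ∈ S x}) :
    ∃ c : ι → κ, ∀ J : Finset ι, J.card ≤ ∑ k, r k {x ∈ J | c x = k} := by
  -- Colours are deleted one at a time; the induction is on the total number of admissible colours.
  induction hN : ∑ x, (S x).card using Nat.strong_induction_on generalizing S with
  | _ N ih =>
  have hne : ∀ x, (S x).Nonempty := by
    intro x
    by_contra hx
    rw [Finset.not_nonempty_iff_eq_empty] at hx
    have h := hS {x}
    simp [Finset.filter_singleton, hx, h0] at h
  by_cases h1 : ∀ x, (S x).card ≤ 1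
  · choose c hc using fun x => Finset.card_eq_one.mp
      (le_antisymm (h1 x) (Finset.card_pos.mpr (hne x)))
    refine ⟨c, fun J => (hS J).trans_eq ?_⟩
    simp [hc, eq_comm]
  · push Not at h1
    obtain ⟨x, hx⟩ := h1
    obtain ⟨i, hi, j, hj, hij⟩ := Finset.one_lt_card.mp hx
    have step : ∀ i ∈ S x,
        (∀ J : Finset ι, J.card ≤ ∑ k, r k {y ∈ J | k ∈ Function.update S x ((S x).erase i) y}) →
        ∃ c : ι → κ, ∀ J : Finset ι, J.card ≤ ∑ k, r k {y ∈ J | c y = k} := by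
      intro i hi h
      refine ih _ ?_ _ h rfl
      rw [← hN]
      refine Finset.sum_lt_sum (fun y _ => ?_) ⟨x, Finset.mem_univ _, ?_⟩
      · rcases eq_or_ne y x with rfl | hy
        · simpa using Finset.card_le_card (Finset.erase_subset i (S y))
        · simp [hy]
      · simpa using Finset.card_erase_lt_of_mem hi
    by_cases hA : ∀ J : Finset ι,
        J.card ≤ ∑ k, r k {y ∈ J | k ∈ Function.update S x ((S x).erase i) y}
    · exact step i hi hA
    by_cases hB : ∀ J : Finset ι,
        J.card ≤ ∑ k, r k {y ∈ J | k ∈ Function.update S x ((S x).erase j) y}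
    · exact step j hj hB
    exfalso
    push Not at hA hB
    have mem : ∀ i (J : Finset ι),
        ∑ k, r k {y ∈ J | k ∈ Function.update S x ((S x).erase i) y} < J.card → x ∈ J := by
      intro i J hJ
      by_contra hxJ
      refine absurd (hS J) (not_le.mpr (lt_of_eq_of_lt ?_ hJ))
      refine Finset.sum_congr rfl fun k _ => ?_
      congr 1
      refine Finset.filter_congr fun y hy => ?_
      rw [Function.update_of_ne]
      rintro rfl
      exact hxJ hy
    obtain ⟨J, hJ⟩ := hA
    obtain ⟨K, hK⟩ := hB
    have hxJ := mem i J hJ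
    have hxK := mem j K hK
    -- Uncrossing: `J` and `K` are violated after deleting `i`, respectively `j`, at `x`. Since `i ≠
    -- j`, their union still sees every colour of `x`, and `x` is dropped from the intersection. The
    -- sizes then lose 1 in total while the two violations lose 2, a contradiction.
    have key : ∀ k, r k {y ∈ J ∪ K | k ∈ S y} + r k {y ∈ (J ∩ K).erase x | k ∈ S y} ≤
        r k {y ∈ J | k ∈ Function.update S x ((S x).erase i) y} +
        r k {y ∈ K | k ∈ Function.update S x ((S x).erase j) y} := by
      intro k
      refine le_trans (add_le_add (hmono k ?_) (hmono k ?_)) (hsub k _ _)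
      · intro y hy
        rcases eq_or_ne y x with rfl | hyx
        · by_cases hki : k = i
          · subst hki
            simp_all
          · simp_all
        · simp_all
      · intro y hy
        have hyx : y ≠ x := by
          rintro rfl
          simp at hy
        simp_all
    have hsum := Finset.sum_le_sum fun k (_ : k ∈ Finset.univ) => key k
    rw [Finset.sum_add_distrib, Finset.sum_add_distrib] at hsum
    have h1 := hS (J ∪ K)
    have h2 := hS ((J ∩ K).erase x)
    rw [Finset.card_erase_of_mem (Finset.mem_inter.mpr ⟨hxJ, hxK⟩)] at h2
    have h3 := Finset.card_union_add_card_inter J K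
    have h4 := Finset.card_pos.mpr ⟨x, hxJ⟩
    omega

/-- The rank of a finite set, as a natural number. -/
def finRank {E : Type*} (M : Matroid E) (A : Finset E) : ℕ := (M.eRk A).toNat

theorem coe_finRank {E : Type*} (M : Matroid E) (A : Finset E) :
    (finRank M A : ℕ∞) = M.eRk A :=
  ENat.natCast_toNat (ne_top_of_le_ne_top (by simp) (M.eRk_le_encard A))

theorem finRank_empty {E : Type*} (M : Matroid E) : finRank M ∅ = 0 := by
  simp [finRank]

theorem finRank_mono {E : Type*} (M : Matroid E) : Monotone (finRank M) := fun A B h => by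
  rw [← ENat.natCast_le_natCast, coe_finRank, coe_finRank]
  exact M.eRk_mono (Finset.coe_subset.mpr h)

theorem finRank_submodular {E : Type*} [DecidableEq E] (M : Matroid E) (A B : Finset E) :
    finRank M (A ∪ B) + finRank M (A ∩ B) ≤ finRank M A + finRank M B := by
  rw [← ENat.natCast_le_natCast]
  push_cast [coe_finRank]
  rw [add_comm]
  exact M.eRk_inter_add_eRk_union_le A B

theorem indep_of_card_le_finRank {E : Type*} (M : Matroid E) (A : Finset E)
    (h : A.card ≤ finRank M A) : M.Indep (A : Set E) := by
  rw [M.indep_iff_eRk_eq_encard_of_finite A.finite_toSet]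
  refine le_antisymm (M.eRk_le_encard _) ?_
  rw [← coe_finRank, Set.encard_coe_eq_coe_finsetCard]
  exact_mod_cast h

/-- An independent set meets `A` in at most r(A) elements, and everything else in the union lies
outside `A`. This is the easy half of the matroid union formula. -/
theorem maxUnion_le {E : Type*} [Fintype E] [DecidableEq E] (M : Matroid E) (k : ℕ)
    (A : Finset E) : maxUnion M k ≤ Aᶜ.card + k * finRank M A := by
  refine csSup_le ⟨0, fun _ => ∅, by simp⟩ ?_
  rintro _ ⟨I, hI, rfl⟩
  have hsub : (⋃ j, I j) ⊆ (Aᶜ : Finset E) ∪ ⋃ j, (I j ∩ A) := by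
    intro x hx
    by_cases hxA : x ∈ A
    · right
      simpa [hxA] using hx
    · left
      simpa using hxA
  refine (Set.ncard_le_ncard hsub (Set.toFinite _)).trans ((Set.ncard_union_le _ _).trans ?_)
  rw [Set.ncard_coe_finset]
  refine Nat.add_le_add_left ((Set.ncard_iUnion_le_of_fintype _).trans ?_) _
  refine (Finset.sum_le_card_nsmul _ _ (finRank M A) fun j _ => ?_).trans (by simp)
  rw [← ENat.natCast_le_natCast, coe_finRank, (Set.toFinite _).cast_ncard_eq]
  exact ((hI j).subset Set.inter_subset_left).encard_le_eRk_of_subset Set.inter_subset_right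

/-- Here `k` marks where the decreasing parts drop to `r`: before it every minimum is `r`, after it
the minimum is the part itself. This links dominance to the truncated ranks min(λ_i, r). -/
theorem exists_sum_add_mul_le_sum_min {lam : ℕ → ℕ} (h : Antitone lam) (r N : ℕ) :
    ∃ k, ∑ i ∈ Finset.range N, lam i + k * r ≤
      ∑ i ∈ Finset.range N, min (lam i) r + ∑ i ∈ Finset.range k, lam i := by
  induction N with
  | zero => exact ⟨0, by simp⟩
  | succ N ih =>
    rcases le_total (lam N) r with hN | hN
    · obtain ⟨k, hk⟩ := ih
      refine ⟨k, ?_⟩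
      rw [Finset.sum_range_succ, Finset.sum_range_succ, min_eq_left hN]
      omega
    · refine ⟨N + 1, ?_⟩
      have : ∑ i ∈ Finset.range (N + 1), min (lam i) r = (N + 1) * r := by
        rw [Finset.sum_congr rfl (g := fun _ => r)]
        · simp
        · intro i hi
          exact min_eq_right (hN.trans (h (by simpa [Nat.lt_succ_iff] using hi)))
      omega

/-- If `lam` is dominated by the rank partition, then the ground set can be partitioned into
independent sets whose sizes are the parts of `lam`. -/
theorem exists_indep_partition {E : Type*} [Fintype E] (M : Matroid E) {lam : ℕ → ℕ}
    (hanti : Antitone lam) {N : ℕ} (hN : ∑ i ∈ Finset.range N, lam i = Fintype.card E)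
    (hdom : DominatedBy lam (rankPartition M)) :
    ∃ c : E → Fin N, ∀ i, M.Indep {x | c x = i} ∧ Set.ncard {x | c x = i} = lam i := by
  classical
  obtain ⟨c, hc⟩ := exists_colouring_of_submodular (ι := E) (κ := Fin N)
    (fun i A => min (lam i) (finRank M A)) (by simp [finRank_empty])
    (fun i A B h => min_le_min le_rfl (finRank_mono M h))
    (fun i A B => by
      have h1 := finRank_submodular M A B
      have h2 := finRank_mono M (Finset.inter_subset_left (s₁ := A) (s₂ := B))
      have h3 := finRank_mono M (Finset.inter_subset_right (s₁ := A) (s₂ := B))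
      have h4 := finRank_mono M (Finset.subset_union_left (s₁ := A) (s₂ := B))
      have h5 := finRank_mono M (Finset.subset_union_right (s₁ := A) (s₂ := B))
      omega)
    (fun _ => Finset.univ)
    (fun A => by
      -- The terms k·r(A) cancel between this bound and `maxUnion_le`, leaving |A| ≤ ∑ min(λ_i,
      -- r(A)).
      obtain ⟨k, hk⟩ := exists_sum_add_mul_le_sum_min hanti (finRank M A) N
      have h1 := hdom k
      rw [sum_rankPartition] at h1
      have h2 := maxUnion_le M k A
      have h3 := Finset.card_add_card_compl A
      simp only [Finset.mem_univ, Finset.filter_true]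
      rw [Fin.sum_univ_eq_sum_range fun i => min (lam i) (finRank M A)]
      omega)
  -- Apply the inequality to a single colour class: the other summands are ranks of the empty set.
  have key : ∀ i, (Finset.univ.filter fun x => c x = i).card ≤
      min (lam i) (finRank M (Finset.univ.filter fun x => c x = i)) := by
    intro i
    refine (hc _).trans_eq ((Finset.sum_eq_single i ?_ (by simp)).trans ?_)
    · intro k _ hk
      rw [Finset.filter_filter, Finset.filter_false_of_mem, finRank_empty, min_zero _]
      rintro x - ⟨h1, h2⟩
      exact hk (h2.symm.trans h1)
    · simp [Finset.filter_filter]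
  have hsum : ∑ i, (Finset.univ.filter fun x => c x = i).card = ∑ i : Fin N, lam i := by
    rw [Fin.sum_univ_eq_sum_range, hN, ← Finset.card_univ,
      Finset.card_eq_sum_card_fiberwise (f := c) (t := Finset.univ) (by simp)]
  -- Class sizes and parts have the same total, so the termwise inequalities are equalities.
  have heq := (Finset.sum_eq_sum_iff_of_le fun i _ => (key i).trans (min_le_left _ _)).mp hsum
  refine ⟨c, fun i => ⟨?_, ?_⟩⟩
  · simpa using indep_of_card_le_finRank M _ ((key i).trans (min_le_right _ _))
  · rw [← heq i (Finset.mem_univ _), ← Set.ncard_coe_finset]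
    simp

/-! ### Expansion of the Laplace pairing -/

/-- The content of a word in the places. -/
def content {k : ℕ} (c : Fin k → ℕ) : ℕ →₀ ℕ := ∑ i, Finsupp.single (c i) 1

theorem laplaceLetter_eq_sum {E κ : Type*} [Fintype κ] {q : κ → ℕ} (hq : Function.Injective q)
    (e : E) (β : ℕ →₀ ℕ) (hβ : (β.support : Set ℕ) ⊆ Set.range q) :
    laplaceLetter e β =
      ∑ p, if Finsupp.single (q p) 1 = β then ExteriorAlgebra.ι ℤ (pair e (q p)) else 0 := by
  classical
  unfold laplaceLetter
  split_ifs with h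
  · obtain ⟨m, rfl⟩ : ∃ m, β = Finsupp.single m 1 := by
      rw [Finsupp.degree_apply] at h
      have h1 : β.support.card ≤ 1 := by
        rw [← h, Finset.card_eq_sum_ones]
        exact Finset.sum_le_sum fun i hi =>
          Nat.one_le_iff_ne_zero.mpr (Finsupp.mem_support_iff.mp hi)
      obtain ⟨m, hm⟩ := Finset.card_le_one_iff_subset_singleton.mp h1
      obtain ⟨b, rfl⟩ := Finsupp.support_subset_singleton'.mp hm
      refine ⟨m, ?_⟩
      rcases eq_or_ne b 0 with rfl | hb
      · simp at h
      · rw [Finsupp.support_single _ hb] at h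
        simp at h
        rw [h]
    have hs : (Finsupp.single m 1 : ℕ →₀ ℕ).support = {m} :=
      Finsupp.support_single _ one_ne_zero
    rw [hs] at hβ ⊢
    obtain ⟨p, rfl⟩ := hβ (by simp : m ∈ (({m} : Finset ℕ) : Set ℕ))
    rw [Finset.sum_singleton, Finset.sum_eq_single p]
    · simp
    · intro p' _ hp
      rw [if_neg]
      intro h
      exact hp (hq ((Finsupp.single_left_inj one_ne_zero).mp h))
    · simp
  · refine (Finset.sum_eq_zero fun p _ => if_neg ?_).symm
    rintro rfl
    simp at h

/-- The Laplace pairing as a sum over all words in the places with the given content. -/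
theorem laplace_ofFn {E κ : Type*} [Fintype κ] {q : κ → ℕ} (hq : Function.Injective q)
    {k : ℕ} (w : Fin k → E) (α : ℕ →₀ ℕ) (hα : (α.support : Set ℕ) ⊆ Set.range q) :
    laplace (List.ofFn w) α =
      ∑ c : Fin k → κ, if content (q ∘ c) = α then
        ExteriorAlgebra.ιMulti ℤ k (fun i => pair (w i) (q (c i))) else 0 := by
  classical
  induction k generalizing α with
  | zero => simp [laplace, content, eq_comm]
  | succ k ih =>
    rw [List.ofFn_succ, laplace]
    have hsupp : ∀ x ∈ Finset.HasAntidiagonal.antidiagonal α,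
        ((x.1.support : Set ℕ) ⊆ Set.range q) ∧ ((x.2.support : Set ℕ) ⊆ Set.range q) := by
      intro x hx
      rw [Finset.HasAntidiagonal.mem_antidiagonal] at hx
      subst hx
      constructor
      · exact subset_trans (Finset.coe_subset.mpr (Finsupp.support_mono le_self_add)) hα
      · exact subset_trans (Finset.coe_subset.mpr (Finsupp.support_mono le_add_self)) hα
    have h1 : ∀ x ∈ Finset.HasAntidiagonal.antidiagonal α,
        laplaceLetter (w 0) x.1 * laplace (List.ofFn fun i => w i.succ) x.2 =
        ∑ p, ∑ c : Fin k → κ, if x = (Finsupp.single (q p) 1, content (q ∘ c)) then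
          ExteriorAlgebra.ι ℤ (pair (w 0) (q p)) *
            ExteriorAlgebra.ιMulti ℤ k (fun i => pair (w i.succ) (q (c i))) else 0 := by
      intro x hx
      rw [laplaceLetter_eq_sum hq _ _ (hsupp x hx).1, ih _ _ (hsupp x hx).2, Finset.sum_mul_sum]
      refine Finset.sum_congr rfl fun p _ => Finset.sum_congr rfl fun c _ => ?_
      simp only [Prod.ext_iff, eq_comm (a := x.1), eq_comm (a := x.2)]
      by_cases h1 : Finsupp.single (q p) 1 = x.1 <;> by_cases h2 : content (q ∘ c) = x.2 <;>
        simp [h1, h2]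
    rw [Finset.sum_congr rfl h1, Finset.sum_comm, ← (Fin.consEquiv fun _ => κ).sum_comp,
      Fintype.sum_prod_type]
    refine Finset.sum_congr rfl fun p _ => ?_
    rw [Finset.sum_comm]
    refine Finset.sum_congr rfl fun c _ => ?_
    simp only [Finset.sum_ite_eq', Finset.HasAntidiagonal.mem_antidiagonal, Fin.consEquiv,
      Equiv.coe_fn_mk, content, Fin.sum_univ_succ, Function.comp_apply,
      Fin.cons_zero, Fin.cons_succ, ExteriorAlgebra.ιMulti_succ_apply]
    rfl

/-- Equal content means that every place q_j is hit, and a surjection of a finite set to itself is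
bijective. -/
theorem content_comp_eq_iff {k : ℕ} {q : Fin k → ℕ} (hq : Function.Injective q)
    (c : Fin k → Fin k) : content (q ∘ c) = content q ↔ Function.Bijective c := by
  classical
  constructor
  · intro h
    refine Finite.surjective_iff_bijective.mp fun j => ?_
    by_contra hj
    push Not at hj
    have := DFunLike.congr_fun h (q j)
    simp [content, Finsupp.finsetSum_apply, Finsupp.single_apply, hq.eq_iff, hj] at this
  · intro h
    exact (Equiv.ofBijective c h).sum_comp fun i => Finsupp.single (q i) 1

/-- The Laplace pairing of a word with a product of distinct places. -/
theorem laplace_ofFn_content {E : Type*} {k : ℕ} {q : Fin k → ℕ} (hq : Function.Injective q)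
    (w : Fin k → E) :
    laplace (List.ofFn w) (content q) =
      ∑ s : Equiv.Perm (Fin k), ExteriorAlgebra.ιMulti ℤ k (fun i => pair (w i) (q (s i))) := by
  classical
  rw [laplace_ofFn hq]
  · simp only [content_comp_eq_iff hq]
    rw [← Finset.sum_filter]
    refine (Finset.sum_bij (fun (s : Equiv.Perm (Fin k)) _ => (s : Fin k → Fin k)) ?_ ?_ ?_ ?_).symm
    · intro s _
      exact Finset.mem_filter.mpr ⟨Finset.mem_univ _, s.bijective⟩
    · intro s _ t _ h
      exact DFunLike.coe_injective h
    · intro c hc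
      exact ⟨Equiv.ofBijective c (by simpa using hc), Finset.mem_univ _, rfl⟩
    · intro s _
      rfl
  · intro x hx
    by_contra hq'
    rw [Finset.mem_coe, Finsupp.mem_support_iff] at hx
    refine hx ?_
    rw [content, Finsupp.finsetSum_apply]
    refine Finset.sum_eq_zero fun i _ => Finsupp.single_eq_of_ne ?_
    rintro rfl
    exact hq' ⟨i, rfl⟩

/-! ### Vanishing of row antisymmetrizations of dependent words -/

theorem toWhitney_laplace {E : Type*} {M : Matroid E} {k : ℕ} {w : Fin k → E}
    (hw : M.Dep (Set.range w)) {α : ℕ →₀ ℕ} (hα : α.degree = k) :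
    toWhitney M (laplace (List.ofFn w) α) = 0 := by
  rw [toWhitney, ← map_zero (RingQuot.mkAlgHom ℤ (WhitneyRel M))]
  refine RingQuot.mkAlgHom_rel ℤ (.dep _ _ ?_ (by simpa using hα))
  convert hw
  ext x
  simp [List.mem_ofFn]

theorem degree_content {k : ℕ} (c : Fin k → ℕ) : (content c).degree = k := by
  simp [content, map_sum]

/-- With distinct places the words of the given content are exactly the permutations, so this sum is
the image of a defining relation. -/
theorem sum_monomial_perm_eq_zero {E : Type*} {M : Matroid E} {k : ℕ} {w : Fin k → E}
    (hw : M.Dep (Set.range w)) {q : Fin k → ℕ} (hq : Function.Injective q) :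
    ∑ s : Equiv.Perm (Fin k), monomial M w (fun i => q (s i)) = 0 := by
  rw [← toWhitney_laplace hw (degree_content q), laplace_ofFn_content hq, map_sum]
  rfl

theorem monomial_append {E : Type*} (M : Matroid E) {k l : ℕ} (w : Fin (k + l) → E)
    (c : Fin (k + l) → ℕ) :
    monomial M w c = monomial M (w ∘ Fin.castAdd l) (c ∘ Fin.castAdd l) *
      monomial M (w ∘ Fin.natAdd k) (c ∘ Fin.natAdd k) := by
  rw [monomial, monomial, monomial, ← map_mul, ExteriorAlgebra.ιMulti_mul_ιMulti]
  congr 2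
  exact (Fin.append_castAdd_natAdd (f := fun i => pair (w i) (c i))).symm

theorem monomial_comp_perm {E : Type*} (M : Matroid E) {n : ℕ} (w : Fin n → E) (c : Fin n → ℕ)
    (t : Equiv.Perm (Fin n)) :
    monomial M (w ∘ t) (c ∘ t) = (Equiv.Perm.sign t : ℤ) • monomial M w c := by
  rw [monomial, monomial, ← map_zsmul, ← Units.smul_def, ← AlternatingMap.map_perm]
  rfl

/-- The extension of a permutation of some positions to all positions. -/
def extendPositions {k l n : ℕ} (t : Fin k ⊕ Fin l ≃ Fin n) (s : Equiv.Perm (Fin k)) :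
    Equiv.Perm (Fin n) :=
  t.permCongr (Equiv.Perm.sumCongr s 1)

theorem extendPositions_inl {k l n : ℕ} (t : Fin k ⊕ Fin l ≃ Fin n) (s : Equiv.Perm (Fin k))
    (i : Fin k) : extendPositions t s (t (.inl i)) = t (.inl (s i)) := by
  simp [extendPositions, Equiv.permCongr_apply]

theorem extendPositions_inr {k l n : ℕ} (t : Fin k ⊕ Fin l ≃ Fin n) (s : Equiv.Perm (Fin k))
    (i : Fin l) : extendPositions t s (t (.inr i)) = t (.inr i) := by
  simp [extendPositions, Equiv.permCongr_apply]

theorem extendPositions_inv {k l n : ℕ} (t : Fin k ⊕ Fin l ≃ Fin n) (s : Equiv.Perm (Fin k)) :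
    (extendPositions t s)⁻¹ = extendPositions t s⁻¹ := by
  refine inv_eq_of_mul_eq_one_right (Equiv.ext fun x => ?_)
  obtain ⟨y | y, rfl⟩ := t.surjective x
  · simp [extendPositions_inl]
  · simp [extendPositions_inr]

/-- Permuting the places of a set of positions with dependent letters in all possible ways gives
the sum zero. -/
theorem sum_monomial_extendPositions_eq_zero {E : Type*} {M : Matroid E} {k l n : ℕ}
    {w : Fin n → E} {c : Fin n → ℕ} (hc : Function.Injective c) (t : Fin k ⊕ Fin l ≃ Fin n)
    (hw : M.Dep (Set.range (w ∘ t ∘ Sum.inl))) :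
    ∑ s, monomial M w (fun i => c (extendPositions t s i)) = 0 := by
  obtain rfl : n = k + l := by simpa using (Fintype.card_congr t).symm
  let t' : Equiv.Perm (Fin (k + l)) := finSumFinEquiv.symm.trans t
  have ht' : ∀ i, t' (Fin.castAdd l i) = t (.inl i) := fun i => by simp [t']
  have ht'' : ∀ i, t' (Fin.natAdd k i) = t (.inr i) := fun i => by simp [t']
  have h : ∀ s, (Equiv.Perm.sign t' : ℤ) • monomial M w (fun i => c (extendPositions t s i)) =
      monomial M (w ∘ t ∘ Sum.inl) (fun i => c (t (.inl (s i)))) *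
      monomial M (w ∘ t ∘ Sum.inr) (c ∘ t ∘ Sum.inr) := by
    intro s
    rw [← monomial_comp_perm, monomial_append]
    congr 2 <;> funext i <;> simp [ht', ht'', extendPositions_inl, extendPositions_inr]
  have h2 : (Equiv.Perm.sign t' : ℤ) • ∑ s, monomial M w (fun i => c (extendPositions t s i)) =
      0 := by
    rw [Finset.smul_sum, Finset.sum_congr rfl fun s _ => h s, ← Finset.sum_mul,
      sum_monomial_perm_eq_zero hw (q := fun i => c (t (.inl i)))
        (hc.comp (t.injective.comp Sum.inl_injective)), zero_mul]
  -- The sign is a unit, so it can be cancelled even if W(M) has torsion.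
  rw [← Units.smul_def] at h2
  exact (smul_eq_zero_iff_eq _).mp h2

/-! ### Evaluation of the Whitney module of a realized matroid -/

section Evaluation

variable {V N : Type*} [AddCommGroup V] [Module ℂ V] [AddCommGroup N] [Module ℂ N]

/-- The sum of the products `θ_{c₁}(v₁) ∧ ⋯ ∧ θ_{c_k}(v_k)` over a set of words `c` that is closed
under permutation of the positions is alternating in `v`. -/
def sumWedge {κ : Type*} [Fintype κ] (θ : κ → V →ₗ[ℂ] N) {k : ℕ} (S : Finset (Fin k → κ))
    (hS : ∀ c ∈ S, ∀ σ : Equiv.Perm (Fin k), c ∘ σ ∈ S) :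
    V [⋀^Fin k]→ₗ[ℂ] ExteriorAlgebra ℂ N where
  toMultilinearMap := ∑ c ∈ S,
    (ExteriorAlgebra.ιMulti ℂ k).toMultilinearMap.compLinearMap fun i => θ (c i)
  map_eq_zero_of_eq' v i j hv hij := by
    have hsymm : ∀ l, v (Equiv.swap i j l) = v l := by
      intro l
      rcases eq_or_ne l i with rfl | hi
      · simpa using hv.symm
      rcases eq_or_ne l j with rfl | hj
      · simpa using hv
      rw [Equiv.swap_apply_of_ne_of_ne hi hj]
    -- As v_i = v_j, swapping two letters of the word `c` is the same as swapping two factors of the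
    -- wedge product. Reindexing by this swap shows that the sum equals its own negative.
    have hneg : ∀ c : Fin k → κ,
        ExteriorAlgebra.ιMulti ℂ k (fun l => θ ((c ∘ Equiv.swap i j) l) (v l)) =
          -ExteriorAlgebra.ιMulti ℂ k (fun l => θ (c l) (v l)) := by
      intro c
      rw [← AlternatingMap.map_swap _ _ hij]
      congr 1
      funext l
      simp [hsymm]
    have hsum : (∑ c ∈ S, ExteriorAlgebra.ιMulti ℂ k (fun l => θ (c l) (v l))) =
        -∑ c ∈ S, ExteriorAlgebra.ιMulti ℂ k (fun l => θ (c l) (v l)) := by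
      rw [← Finset.sum_neg_distrib, ← Finset.sum_congr rfl fun c _ => hneg c]
      refine Finset.sum_bij' (fun c _ => c ∘ Equiv.swap i j) (fun c _ => c ∘ Equiv.swap i j)
        (fun c hc => hS c hc _) (fun c hc => hS c hc _) ?_ ?_ ?_
      · intro c _
        funext l
        simp
      · intro c _
        funext l
        simp
      · intro c _
        congr 1
        funext l
        simp
    have h : (2 : ℂ) • ∑ c ∈ S, ExteriorAlgebra.ιMulti ℂ k (fun l => θ (c l) (v l)) = 0 := by
      rw [two_smul]
      nth_rw 1 [hsum]
      exact neg_add_cancel _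
    simpa using h

theorem sumWedge_apply {κ : Type*} [Fintype κ] (θ : κ → V →ₗ[ℂ] N) {k : ℕ}
    (S : Finset (Fin k → κ)) (hS : ∀ c ∈ S, ∀ σ : Equiv.Perm (Fin k), c ∘ σ ∈ S) (v : Fin k → V) :
    sumWedge θ S hS v = ∑ c ∈ S, ExteriorAlgebra.ιMulti ℂ k (fun i => θ (c i) (v i)) := by
  change (∑ c ∈ S, (ExteriorAlgebra.ιMulti ℂ k).toMultilinearMap.compLinearMap
    fun i => θ (c i)) v = _
  simp

/-- The algebra homomorphism `(e|p) ↦ θ_p(f(e))`. -/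
def evalLetterPlace {E : Type*} (f : E → V) (θ : ℕ → V →ₗ[ℂ] N) :
    LetterPlace E →ₐ[ℤ] ExteriorAlgebra ℂ N :=
  ExteriorAlgebra.lift ℤ
    ⟨((ExteriorAlgebra.ι ℂ).restrictScalars ℤ).comp
      (Finsupp.linearCombination ℤ fun x : E × ℕ => θ x.2 (f x.1)),
      fun _ => ExteriorAlgebra.ι_sq_zero _⟩

theorem evalLetterPlace_ι_pair {E : Type*} (f : E → V) (θ : ℕ → V →ₗ[ℂ] N) (e : E) (p : ℕ) :
    evalLetterPlace f θ (ExteriorAlgebra.ι ℤ (pair e p)) = ExteriorAlgebra.ι ℂ (θ p (f e)) := by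
  refine (ExteriorAlgebra.lift_ι_apply ℤ _ _ _).trans ?_
  simp [pair]

theorem evalLetterPlace_ιMulti {E : Type*} (f : E → V) (θ : ℕ → V →ₗ[ℂ] N) {k : ℕ}
    (w : Fin k → E) (c : Fin k → ℕ) :
    evalLetterPlace f θ (ExteriorAlgebra.ιMulti ℤ k fun i => pair (w i) (c i)) =
      ExteriorAlgebra.ιMulti ℂ k fun i => θ (c i) (f (w i)) := by
  rw [ExteriorAlgebra.ιMulti_apply, ExteriorAlgebra.ιMulti_apply, map_list_prod, List.map_ofFn]
  congr 2
  funext i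
  exact evalLetterPlace_ι_pair f θ _ _

/-- After evaluation the pairing is the `sumWedge` over all words of content `α`. It is alternating
and multilinear in the vectors, so it vanishes on dependent families. -/
theorem evalLetterPlace_laplace {E : Type*} (f : E → V) (θ : ℕ → V →ₗ[ℂ] N) {k : ℕ}
    (w : Fin k → E) (hw : ¬ LinearIndependent ℂ (f ∘ w)) (α : ℕ →₀ ℕ) :
    evalLetterPlace f θ (laplace (List.ofFn w) α) = 0 := by
  classical
  -- Only places in the support of `α` can occur, which gives a finite alphabet.
  rw [laplace_ofFn (κ := α.support) Subtype.val_injective _ _ (by rw [Subtype.range_coe]), map_sum]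
  simp only [apply_ite (evalLetterPlace f θ), map_zero, evalLetterPlace_ιMulti]
  rw [← Finset.sum_filter]
  refine (sumWedge_apply (fun p : α.support => θ p) _ ?_ (f ∘ w)).symm.trans
    (AlternatingMap.map_linearDependent _ _ hw)
  intro c hc σ
  simp only [Finset.mem_filter, Finset.mem_univ, true_and] at hc ⊢
  refine Eq.trans ?_ hc
  exact Equiv.sum_comp σ fun i => Finsupp.single ((c i : ℕ)) 1

theorem not_linearIndependent_of_dep {E : Type*} {M : Matroid E} {f : E → V}
    (hf : ∀ I : Set E, M.Indep I ↔ LinearIndepOn ℂ f I) {k : ℕ} {w : Fin k → E}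
    (hw : M.Dep (Set.range w)) : ¬ LinearIndependent ℂ (f ∘ w) := by
  intro h
  refine hw.not_indep ((hf _).mpr ?_)
  exact (linearIndepOn_range_iff (Function.Injective.of_comp h.injective) f).mpr h

/-- The algebra homomorphism `(e|p) ↦ θ_p(f(e))` on the Whitney module of a matroid that is
realized by `f`. -/
def evalWhitney {E : Type*} {M : Matroid E} {f : E → V}
    (hf : ∀ I : Set E, M.Indep I ↔ LinearIndepOn ℂ f I) (θ : ℕ → V →ₗ[ℂ] N) :
    WhitneyModule M →ₐ[ℤ] ExteriorAlgebra ℂ N :=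
  RingQuot.liftAlgHom ℤ ⟨evalLetterPlace f θ, by
    rintro _ _ ⟨w, α, hw, hα⟩
    rw [map_zero]
    have hr : Set.range w.get = {e | e ∈ w} := by
      ext x
      simp [List.mem_iff_get]
    rw [← List.ofFn_get w]
    exact evalLetterPlace_laplace f θ w.get (not_linearIndependent_of_dep hf (hr ▸ hw)) α⟩

theorem evalWhitney_monomial {E : Type*} {M : Matroid E} {f : E → V}
    (hf : ∀ I : Set E, M.Indep I ↔ LinearIndepOn ℂ f I) (θ : ℕ → V →ₗ[ℂ] N) {k : ℕ}
    (w : Fin k → E) (c : Fin k → ℕ) :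
    evalWhitney hf θ (monomial M w c) =
      ExteriorAlgebra.ιMulti ℂ k fun i => θ (c i) (f (w i)) := by
  rw [monomial, toWhitney, evalWhitney, RingQuot.liftAlgHom_mkAlgHom_apply]
  exact evalLetterPlace_ιMulti f θ w c

end Evaluation

/-- The linear functional on `W(M)` that takes the product `(a₁|p₁) ⋯ (a_n|p_n)` to
`φ₁(f(a₁)) ⋯ φ_n(f(a_n))`. -/
theorem exists_functional {E V : Type*} [AddCommGroup V] [Module ℂ V] {M : Matroid E} {f : E → V}
    (hf : ∀ I : Set E, M.Indep I ↔ LinearIndepOn ℂ f I) {n : ℕ} (φ : Fin n → V →ₗ[ℂ] ℂ) :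
    ∃ ψ : WhitneyModule M →ₗ[ℤ] ℂ, ∀ a : Fin n → E,
      ψ (monomial M a fun i => (i : ℕ)) = ∏ i, φ i (f (a i)) := by
  classical
  -- The place p is sent to φ_p times the p-th basis vector, so the monomial becomes the wedge of
  -- the rows of a diagonal matrix. Places from `n` on do not occur and get 0; `D` is the
  -- determinant in degree `n` and 0 in all other degrees.
  let θ : ℕ → V →ₗ[ℂ] (Fin n → ℂ) := fun p =>
    if h : p < n then (LinearMap.single ℂ (fun _ : Fin n => ℂ) ⟨p, h⟩).comp (φ ⟨p, h⟩) else 0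
  let D : ExteriorAlgebra ℂ (Fin n → ℂ) →ₗ[ℂ] ℂ :=
    ExteriorAlgebra.liftAlternating (Pi.single n Matrix.detRowAlternating)
  refine ⟨(D.restrictScalars ℤ).comp (evalWhitney hf θ).toLinearMap, fun a => ?_⟩
  change D (evalWhitney hf θ _) = _
  rw [evalWhitney_monomial, ExteriorAlgebra.liftAlternating_apply_ιMulti, Pi.single_eq_same]
  change Matrix.det _ = _
  rw [← Matrix.det_diagonal]
  congr 1
  ext i j
  simp [θ, Matrix.diagonal_apply, Pi.single_apply, eq_comm]

/-! ### Group algebras over the complex numbers -/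

section GroupAlgebra

variable {G : Type*} [Group G]

theorem coeff_mul_eq_sum [Fintype G] (x y : MonoidAlgebra ℂ G) (g : G) :
    (x * y).coeff g = ∑ h, x.coeff h * y.coeff (h⁻¹ * g) := by
  rw [MonoidAlgebra.coeff_mul_apply_left, Finsupp.sum_fintype]
  simp

/-- The conjugate transpose of an element of the group algebra. -/
def conjTranspose [Fintype G] (x : MonoidAlgebra ℂ G) : MonoidAlgebra ℂ G :=
  .ofCoeff (Finsupp.equivFunOnFinite.symm fun g => star (x.coeff g⁻¹))

theorem coeff_conjTranspose [Fintype G] (x : MonoidAlgebra ℂ G) (g : G) :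
    (conjTranspose x).coeff g = star (x.coeff g⁻¹) := rfl

/-- The coefficient of x·x* at the identity is ∑ |x_g|². -/
theorem eq_zero_of_mul_conjTranspose_eq_zero [Fintype G] {x : MonoidAlgebra ℂ G}
    (h : x * conjTranspose x = 0) : x = 0 := by
  have h1 := congrArg (fun z : MonoidAlgebra ℂ G => z.coeff 1) h
  simp only [coeff_mul_eq_sum, coeff_conjTranspose, mul_one, inv_inv, MonoidAlgebra.coeff_zero,
    Finsupp.zero_apply] at h1
  have h2 : ∑ g, Complex.normSq (x.coeff g) = 0 := by
    rw [← Complex.ofReal_inj, Complex.ofReal_sum, Complex.ofReal_zero, ← h1]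
    exact Finset.sum_congr rfl fun g _ => (Complex.mul_conj _).symm
  rw [Finset.sum_eq_zero_iff_of_nonneg fun g _ => Complex.normSq_nonneg _] at h2
  refine MonoidAlgebra.coeff_injective (Finsupp.ext fun g => ?_)
  exact Complex.normSq_eq_zero.mp (h2 g (Finset.mem_univ g))

theorem conjTranspose_mul_conjTranspose_self [Fintype G] (x : MonoidAlgebra ℂ G) :
    conjTranspose (x * conjTranspose x) = x * conjTranspose x := by
  refine MonoidAlgebra.coeff_injective (Finsupp.ext fun g => ?_)
  rw [coeff_conjTranspose, coeff_mul_eq_sum, coeff_mul_eq_sum, star_sum,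
    ← Equiv.sum_comp (Equiv.mulLeft g⁻¹)]
  refine Finset.sum_congr rfl fun h _ => ?_
  simp [coeff_conjTranspose, mul_comm]

/-- The group algebra is semiprime. -/
theorem exists_mul_of_mul_ne_zero [Finite G] {x : MonoidAlgebra ℂ G} (hx : x ≠ 0) :
    ∃ g, x * MonoidAlgebra.of ℂ G g * x ≠ 0 := by
  have := Fintype.ofFinite G
  by_contra! h
  have h1 : ∀ y, x * y * x = 0 := by
    intro y
    induction y using MonoidAlgebra.induction_linear with
    | zero => simp
    | add y z hy hz => rw [mul_add, add_mul, hy, hz, add_zero]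
    | single g c =>
      have : MonoidAlgebra.single g c = c • MonoidAlgebra.of ℂ G g := by simp
      rw [this, mul_smul_comm, smul_mul_assoc, h, smul_zero]
  -- For y = x·x* one has y* = y and y·y* = (x·x*·x)·x* = 0, so y = 0 and then x = 0.
  refine hx (eq_zero_of_mul_conjTranspose_eq_zero (eq_zero_of_mul_conjTranspose_eq_zero ?_))
  rw [conjTranspose_mul_conjTranspose_self, ← mul_assoc, h1, zero_mul]

variable {V : Type*} [AddCommGroup V] [Module ℂ V] (ρ : Representation ℂ Gᵐᵒᵖ V)

/-- The action of the group algebra on a right representation: `actOn ρ x h` is `x · h`. -/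
def actOn (x : V) : MonoidAlgebra ℂ G →ₗ[ℂ] V :=
  (Finsupp.linearCombination ℂ fun g => ρ (.op g) x) ∘ₗ
    (MonoidAlgebra.coeffLinearEquiv (S := ℂ) (M := G) ℂ).toLinearMap

theorem actOn_of (x : V) (g : G) : actOn ρ x (MonoidAlgebra.of ℂ G g) = ρ (.op g) x := by
  simp [actOn]

theorem actOn_zero (h : MonoidAlgebra ℂ G) : actOn ρ 0 h = 0 := by
  simp [actOn, Finsupp.linearCombination_apply]

theorem actOn_mul_of (x : V) (h : MonoidAlgebra ℂ G) (g : G) :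
    actOn ρ x (h * MonoidAlgebra.of ℂ G g) = ρ (.op g) (actOn ρ x h) := by
  induction h using MonoidAlgebra.induction_linear with
  | zero => simp
  | add y z hy hz => rw [add_mul, map_add, map_add, map_add, hy, hz]
  | single k c =>
    have : MonoidAlgebra.single k c = c • MonoidAlgebra.of ℂ G k := by simp
    rw [this, smul_mul_assoc, ← map_mul, map_smul, map_smul, map_smul, actOn_of, actOn_of,
      MulOpposite.op_mul, map_mul]
    rfl

theorem actOn_mul (x : V) (h h' : MonoidAlgebra ℂ G) :
    actOn ρ x (h * h') = actOn ρ (actOn ρ x h) h' := by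
  induction h' using MonoidAlgebra.induction_linear with
  | zero => simp
  | add y z hy hz => rw [mul_add, map_add, map_add, hy, hz]
  | single k c =>
    have : MonoidAlgebra.single k c = c • MonoidAlgebra.of ℂ G k := by simp
    rw [this, mul_smul_comm, map_smul, map_smul, actOn_mul_of, actOn_of]

end GroupAlgebra

/-! ### Young symmetrizers -/

section Young

variable {lam : YoungDiagram} {n : ℕ} (T : Tableau lam n)

/-- The row of the tableau that contains an entry. -/
def rowOf (k : Fin n) : ℕ := (T.symm k).1.1

/-- The column of the tableau that contains an entry. -/
def colOf (k : Fin n) : ℕ := (T.symm k).1.2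

theorem mem_rowGroup {σ : Equiv.Perm (Fin n)} :
    σ ∈ rowGroup T ↔ ∀ k, rowOf T (σ k) = rowOf T k := by
  simp [rowGroup, rowOf]

theorem mem_colGroup {σ : Equiv.Perm (Fin n)} :
    σ ∈ colGroup T ↔ ∀ k, colOf T (σ k) = colOf T k := by
  simp [colGroup, colOf]

theorem rowOf_apply {i j : ℕ} (h : (i, j) ∈ lam.cells) : rowOf T (T ⟨(i, j), h⟩) = i := by
  simp [rowOf]

theorem colOf_apply {i j : ℕ} (h : (i, j) ∈ lam.cells) : colOf T (T ⟨(i, j), h⟩) = j := by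
  simp [colOf]

theorem mem_of_rowOf_colOf (k : Fin n) : (rowOf T k, colOf T k) ∈ lam.cells := (T.symm k).2

theorem eq_of_rowOf_eq_of_colOf_eq {k l : Fin n} (h : rowOf T k = rowOf T l)
    (h' : colOf T k = colOf T l) : k = l :=
  T.symm.injective (Subtype.ext (Prod.ext h h'))

theorem mul_mem_rowGroup {σ τ : Equiv.Perm (Fin n)} (hσ : σ ∈ rowGroup T) (hτ : τ ∈ rowGroup T) :
    σ * τ ∈ rowGroup T := by
  rw [mem_rowGroup] at *
  intro k
  rw [Equiv.Perm.mul_apply, hσ, hτ]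

theorem inv_mem_rowGroup {σ : Equiv.Perm (Fin n)} (hσ : σ ∈ rowGroup T) : σ⁻¹ ∈ rowGroup T := by
  rw [mem_rowGroup] at *
  intro k
  rw [← hσ, show σ (σ⁻¹ k) = k from σ.apply_symm_apply k]

theorem mul_mem_colGroup {σ τ : Equiv.Perm (Fin n)} (hσ : σ ∈ colGroup T) (hτ : τ ∈ colGroup T) :
    σ * τ ∈ colGroup T := by
  rw [mem_colGroup] at *
  intro k
  rw [Equiv.Perm.mul_apply, hσ, hτ]

theorem inv_mem_colGroup {σ : Equiv.Perm (Fin n)} (hσ : σ ∈ colGroup T) : σ⁻¹ ∈ colGroup T := by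
  rw [mem_colGroup] at *
  intro k
  rw [← hσ, show σ (σ⁻¹ k) = k from σ.apply_symm_apply k]

/-- The signed sum of the row group. -/
def rowSum : MonoidAlgebra ℂ (Equiv.Perm (Fin n)) :=
  ∑ σ ∈ rowGroup T, ((Equiv.Perm.sign σ : ℤ) : ℂ) • MonoidAlgebra.of ℂ _ σ

/-- The sum of the column group. -/
def colSum : MonoidAlgebra ℂ (Equiv.Perm (Fin n)) :=
  ∑ τ ∈ colGroup T, MonoidAlgebra.of ℂ _ τ

theorem youngSymmetrizer_eq : youngSymmetrizer T = rowSum T * colSum T := rfl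

theorem sign_mul_self (σ : Equiv.Perm (Fin n)) :
    ((Equiv.Perm.sign σ : ℤ) : ℂ) * ((Equiv.Perm.sign σ : ℤ) : ℂ) = 1 := by
  rw [← Int.cast_mul, ← Units.val_mul, Int.units_mul_self]
  simp

theorem of_mul_rowSum {r : Equiv.Perm (Fin n)} (hr : r ∈ rowGroup T) :
    MonoidAlgebra.of ℂ _ r * rowSum T = ((Equiv.Perm.sign r : ℤ) : ℂ) • rowSum T := by
  rw [rowSum, Finset.mul_sum, Finset.smul_sum]
  refine Finset.sum_bij' (fun σ _ => r * σ) (fun σ _ => r⁻¹ * σ)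
    (fun σ hσ => mul_mem_rowGroup T hr hσ)
    (fun σ hσ => mul_mem_rowGroup T (inv_mem_rowGroup T hr) hσ) (by simp) (by simp) ?_
  intro σ _
  rw [mul_smul_comm, ← map_mul, smul_smul, Equiv.Perm.sign_mul, Units.val_mul, Int.cast_mul,
    ← mul_assoc, sign_mul_self, one_mul]

theorem rowSum_mul_of {r : Equiv.Perm (Fin n)} (hr : r ∈ rowGroup T) :
    rowSum T * MonoidAlgebra.of ℂ _ r = ((Equiv.Perm.sign r : ℤ) : ℂ) • rowSum T := by
  rw [rowSum, Finset.sum_mul, Finset.smul_sum]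
  refine Finset.sum_bij' (fun σ _ => σ * r) (fun σ _ => σ * r⁻¹)
    (fun σ hσ => mul_mem_rowGroup T hσ hr)
    (fun σ hσ => mul_mem_rowGroup T hσ (inv_mem_rowGroup T hr)) (by simp) (by simp) ?_
  intro σ _
  rw [smul_mul_assoc, ← map_mul, smul_smul, Equiv.Perm.sign_mul, Units.val_mul, Int.cast_mul,
    mul_left_comm, sign_mul_self, mul_one]

theorem of_mul_colSum {c : Equiv.Perm (Fin n)} (hc : c ∈ colGroup T) :
    MonoidAlgebra.of ℂ _ c * colSum T = colSum T := by
  rw [colSum, Finset.mul_sum]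
  refine Finset.sum_bij' (fun σ _ => c * σ) (fun σ _ => c⁻¹ * σ)
    (fun σ hσ => mul_mem_colGroup T hc hσ)
    (fun σ hσ => mul_mem_colGroup T (inv_mem_colGroup T hc) hσ) (by simp) (by simp) ?_
  intro σ _
  rw [← map_mul]

/-- If no two entries of a row of `T` lie in the same column of `g T`, then the entry at position
`(i, j)` of the tableau obtained by sorting the rows of `T` by their columns in `g T` is in the
diagram. -/
theorem rowOf_colOf_inv_mem_cells {g : Equiv.Perm (Fin n)}
    (hg : ∀ k l, k ≠ l → rowOf T k = rowOf T l → colOf T (g⁻¹ k) ≠ colOf T (g⁻¹ l)) (k : Fin n) :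
    (rowOf T k, colOf T (g⁻¹ k)) ∈ lam.cells := by
  set m := lam.rowLen (rowOf T k) with hm
  -- Count the entries in the first `m` columns of `g T` and of `T`. The totals agree, and no row
  -- has more such entries in `A` than in `B`, so the counts agree row by row. The whole row of `k`
  -- lies in `B`, because `m` is its length, hence also in `A`.
  let A : Finset (Fin n) := {l | colOf T (g⁻¹ l) < m}
  let B : Finset (Fin n) := {l | colOf T l < m}
  have hAB : A.card = B.card :=
    Finset.card_bij' (fun l _ => g⁻¹ l) (fun l _ => g l) (by simp [A, B]) (by simp [A, B])
      (by simp) (by simp)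
  have hle : ∀ i, (A.filter fun l => rowOf T l = i).card ≤
      (B.filter fun l => rowOf T l = i).card := by
    intro i
    rcases le_total (lam.rowLen i) m with h | h
    · refine Finset.card_le_card fun l hl => ?_
      simp only [A, B, Finset.mem_filter, Finset.mem_univ, true_and] at hl ⊢
      refine ⟨lt_of_lt_of_le ?_ h, hl.2⟩
      rw [← hl.2]
      exact YoungDiagram.mem_iff_lt_rowLen.mp (mem_of_rowOf_colOf T l)
    · have h1 : (A.filter fun l => rowOf T l = i).card ≤ (Finset.range m).card := by
        refine Finset.card_le_card_of_injOn (fun l => colOf T (g⁻¹ l)) ?_ ?_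
        · intro l hl
          simp only [A, Finset.coe_filter, Finset.mem_filter, Finset.mem_univ, true_and,
            Set.mem_ofPred_eq] at hl
          simpa using hl.1
        · intro l hl l' hl' hll
          simp only [A, Finset.coe_filter, Finset.mem_filter, Finset.mem_univ, true_and,
            Set.mem_ofPred_eq] at hl hl'
          by_contra hne
          exact hg l l' hne (hl.2.trans hl'.2.symm) hll
      refine h1.trans ?_
      have hmem : ∀ j ∈ Finset.range m, (i, j) ∈ lam.cells := fun j hj =>
        YoungDiagram.mem_iff_lt_rowLen.mpr ((Finset.mem_range.mp hj).trans_le h)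
      refine Finset.card_le_card_of_injOn
        (fun j => if h : (i, j) ∈ lam.cells then T ⟨(i, j), h⟩ else k) ?_ ?_
      · intro j hj
        have := hmem j hj
        simp only [this, dif_pos, B, Finset.coe_filter, Finset.mem_filter, Finset.mem_univ,
          true_and, Set.mem_ofPred_eq, rowOf_apply, colOf_apply, and_true]
        simpa using hj
      · intro j hj j' hj' h
        simp only [hmem j hj, hmem j' hj', dif_pos] at h
        simpa using h
  have hsum : ∑ i ∈ Finset.univ.image (rowOf T), (A.filter fun l => rowOf T l = i).card =
      ∑ i ∈ Finset.univ.image (rowOf T), (B.filter fun l => rowOf T l = i).card := by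
    rw [← Finset.card_eq_sum_card_fiberwise, ← Finset.card_eq_sum_card_fiberwise, hAB]
    · exact fun l _ => Finset.mem_coe.mpr (Finset.mem_image_of_mem _ (Finset.mem_univ _))
    · exact fun l _ => Finset.mem_coe.mpr (Finset.mem_image_of_mem _ (Finset.mem_univ _))
  have heq := (Finset.sum_eq_sum_iff_of_le fun i _ => hle i).mp hsum (rowOf T k)
    (Finset.mem_image_of_mem _ (Finset.mem_univ _))
  have hB : (B.filter fun l => rowOf T l = rowOf T k) =
      Finset.univ.filter fun l => rowOf T l = rowOf T k := by
    rw [Finset.filter_filter]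
    refine Finset.filter_congr fun l _ => ⟨fun h => h.2, fun h => ⟨?_, h⟩⟩
    rw [hm, ← h]
    exact YoungDiagram.mem_iff_lt_rowLen.mp (mem_of_rowOf_colOf T l)
  rw [hB] at heq
  have hA := Finset.eq_of_subset_of_card_le
    (Finset.filter_subset_filter (fun l => rowOf T l = rowOf T k) (Finset.subset_univ A)) heq.ge
  have hk : k ∈ A.filter fun l => rowOf T l = rowOf T k := by
    rw [hA]
    simp
  simp only [A, Finset.mem_filter, Finset.mem_univ, true_and, and_true] at hk
  exact YoungDiagram.mem_iff_lt_rowLen.mpr hk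

/-- Moving every entry `k` within its row of `T` to its column in `g T` is a row permutation `π`,
and `π * g` preserves columns. -/
theorem exists_eq_mul_of_forall_colOf_ne {g : Equiv.Perm (Fin n)}
    (hg : ∀ k l, k ≠ l → rowOf T k = rowOf T l → colOf T (g⁻¹ k) ≠ colOf T (g⁻¹ l)) :
    ∃ r ∈ rowGroup T, ∃ c ∈ colGroup T, g = r * c := by
  let ρ : Fin n → Fin n := fun k => T ⟨(rowOf T k, colOf T (g⁻¹ k)), rowOf_colOf_inv_mem_cells T hg k⟩
  have hinj : Function.Injective ρ := by
    intro k l hkl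
    have := congrArg Subtype.val (T.injective hkl)
    by_contra hne
    exact hg k l hne (Prod.ext_iff.mp this).1 (Prod.ext_iff.mp this).2
  let π : Equiv.Perm (Fin n) := Equiv.ofBijective ρ (Finite.injective_iff_bijective.mp hinj)
  have hπ : ∀ k, π k = ρ k := fun _ => rfl
  have hπ' : π ∈ rowGroup T := by
    rw [mem_rowGroup]
    intro k
    rw [hπ, rowOf_apply]
  refine ⟨π⁻¹, inv_mem_rowGroup T hπ', π * g, ?_, by simp⟩
  rw [mem_colGroup]
  intro k
  rw [Equiv.Perm.mul_apply, hπ, colOf_apply, show g⁻¹ (g k) = k from g.symm_apply_apply k]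

/-- Von Neumann's lemma: either g is a row permutation times a column permutation, or two entries
share a row of `T` and a column of `g T`. In the latter case their transposition is absorbed with
sign −1 on the left and +1 on the right, so the product is zero. -/
theorem rowSum_mul_of_mul_colSum (g : Equiv.Perm (Fin n)) :
    ∃ t : ℂ, rowSum T * MonoidAlgebra.of ℂ _ g * colSum T = t • youngSymmetrizer T := by
  by_cases hg : ∀ k l, k ≠ l → rowOf T k = rowOf T l → colOf T (g⁻¹ k) ≠ colOf T (g⁻¹ l)
  · obtain ⟨r, hr, c, hc, rfl⟩ := exists_eq_mul_of_forall_colOf_ne T hg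
    refine ⟨((Equiv.Perm.sign r : ℤ) : ℂ), ?_⟩
    rw [map_mul, ← mul_assoc, rowSum_mul_of T hr, mul_assoc, of_mul_colSum T hc, smul_mul_assoc,
      youngSymmetrizer_eq]
  · push Not at hg
    obtain ⟨k, l, hne, hrow, hcol⟩ := hg
    refine ⟨0, ?_⟩
    have h1 : Equiv.swap k l ∈ rowGroup T := by
      rw [mem_rowGroup]
      intro i
      rcases eq_or_ne i k with rfl | hi
      · rw [Equiv.swap_apply_left, hrow]
      rcases eq_or_ne i l with rfl | hi'
      · rw [Equiv.swap_apply_right, hrow]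
      rw [Equiv.swap_apply_of_ne_of_ne hi hi']
    have h2 : Equiv.swap (g⁻¹ k) (g⁻¹ l) ∈ colGroup T := by
      rw [mem_colGroup]
      intro i
      rcases eq_or_ne i (g⁻¹ k) with rfl | hi
      · rw [Equiv.swap_apply_left, hcol]
      rcases eq_or_ne i (g⁻¹ l) with rfl | hi'
      · rw [Equiv.swap_apply_right, hcol]
      rw [Equiv.swap_apply_of_ne_of_ne hi hi']
    have h3 : g * Equiv.swap (g⁻¹ k) (g⁻¹ l) = Equiv.swap k l * g := by
      rw [Equiv.mul_swap_eq_swap_mul, show g (g⁻¹ k) = k from g.apply_symm_apply k,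
        show g (g⁻¹ l) = l from g.apply_symm_apply l]
    have h4 : rowSum T * MonoidAlgebra.of ℂ _ g * colSum T =
        -(rowSum T * MonoidAlgebra.of ℂ _ g * colSum T) := by
      nth_rw 1 [← of_mul_colSum T h2]
      rw [← mul_assoc, mul_assoc (rowSum T), ← map_mul, h3, map_mul, ← mul_assoc,
        rowSum_mul_of T h1, Equiv.Perm.sign_swap hne]
      simp
    have h5 : (2 : ℂ) • (rowSum T * MonoidAlgebra.of ℂ _ g * colSum T) = 0 := by
      rw [two_smul]
      nth_rw 1 [h4]
      exact neg_add_cancel _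
    rw [zero_smul]
    simpa using h5

theorem rowSum_mul_mul_colSum (x : MonoidAlgebra ℂ (Equiv.Perm (Fin n))) :
    ∃ t : ℂ, rowSum T * x * colSum T = t • youngSymmetrizer T := by
  induction x using MonoidAlgebra.induction_linear with
  | zero => exact ⟨0, by simp⟩
  | add y z hy hz =>
    obtain ⟨s, hs⟩ := hy
    obtain ⟨t, ht⟩ := hz
    exact ⟨s + t, by rw [mul_add, add_mul, hs, ht, add_smul]⟩
  | single g c =>
    obtain ⟨t, ht⟩ := rowSum_mul_of_mul_colSum T g
    have : MonoidAlgebra.single g c = c • MonoidAlgebra.of ℂ (Equiv.Perm (Fin n)) g := by simp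
    exact ⟨c * t, by rw [this, mul_smul_comm, smul_mul_assoc, ht, smul_smul]⟩

/-- The row and column groups meet only in the identity, so the coefficient at 1 is 1. -/
theorem youngSymmetrizer_ne_zero : youngSymmetrizer T ≠ 0 := by
  classical
  intro h
  have h1 := congrArg (fun z : MonoidAlgebra ℂ (Equiv.Perm (Fin n)) => z.coeff 1) h
  have h2 : (youngSymmetrizer T).coeff 1 = 1 := by
    rw [youngSymmetrizer, Finset.sum_mul_sum, MonoidAlgebra.coeff_sum, Finsupp.finsetSum_apply,
      Finset.sum_eq_single 1]
    · rw [MonoidAlgebra.coeff_sum, Finsupp.finsetSum_apply, Finset.sum_eq_single 1]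
      · simp
      · intro c _ hc
        simp [hc]
      · intro h
        exact absurd (by simp [mem_colGroup]) h
    · intro r hr hr1
      rw [MonoidAlgebra.coeff_sum, Finsupp.finsetSum_apply]
      refine Finset.sum_eq_zero fun c hc => ?_
      have hne : r * c ≠ 1 := by
        intro hrc
        refine hr1 (Equiv.ext fun k => ?_)
        have hrc' : r⁻¹ = c := inv_eq_of_mul_eq_one_right hrc
        have hr' : r ∈ colGroup T := by
          rw [← inv_inv r, hrc']
          exact inv_mem_colGroup T hc
        exact eq_of_rowOf_eq_of_colOf_eq T ((mem_rowGroup T).mp hr k) ((mem_colGroup T).mp hr' k)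
      simp [MonoidAlgebra.single_mul_single, hne]
    · intro h
      exact absurd (by simp [mem_rowGroup]) h
  simp [h2] at h1

variable {V : Type*} [AddCommGroup V] [Module ℂ V]
  (ρ : Representation ℂ (Equiv.Perm (Fin n))ᵐᵒᵖ V)

/-- The irreducible corresponding to `T` appears as soon as its Young symmetrizer does not act
as zero. -/
theorem appears_of_actOn_ne_zero {x : V} (hx : actOn ρ x (youngSymmetrizer T) ≠ 0) :
    Appears T ρ := by
  let φ : (rightIdeal (youngSymmetrizer T)).toSubmodule →ₗ[ℂ] V :=
    (actOn ρ x).comp (rightIdeal (youngSymmetrizer T)).toSubmodule.subtype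
  have hφ : Function.Injective φ := by
    rw [injective_iff_map_eq_zero]
    rintro ⟨_, y, rfl⟩ h
    change actOn ρ x (youngSymmetrizer T * y) = 0 at h
    by_contra hne
    have hz : youngSymmetrizer T * y ≠ 0 := fun h0 => hne (Subtype.ext h0)
    -- Suppose c·y ≠ 0 is in the kernel. By semiprimeness c·y·g·c is nonzero, hence a nonzero
    -- multiple of c; so c would annihilate `x`.
    obtain ⟨g, hg⟩ := exists_mul_of_mul_ne_zero hz
    obtain ⟨t, ht⟩ := rowSum_mul_mul_colSum T
      (colSum T * y * MonoidAlgebra.of ℂ _ g * rowSum T)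
    have h1 : youngSymmetrizer T * y * MonoidAlgebra.of ℂ _ g * youngSymmetrizer T =
        t • youngSymmetrizer T := by
      rw [← ht]
      simp only [youngSymmetrizer_eq, mul_assoc]
    have ht0 : t ≠ 0 := by
      rintro rfl
      rw [← mul_assoc, h1, zero_smul, zero_mul] at hg
      exact hg rfl
    have h2 := congrArg (actOn ρ x) h1
    rw [mul_assoc _ (MonoidAlgebra.of ℂ _ g), actOn_mul, h, map_smul] at h2
    rw [actOn_zero] at h2
    exact (smul_ne_zero ht0 hx) h2.symm
  have hmem : ∀ g v, v ∈ LinearMap.range φ → ρ g v ∈ LinearMap.range φ := by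
    rintro g _ ⟨z, rfl⟩
    refine ⟨(rightIdeal (youngSymmetrizer T)).toRepresentation g z, ?_⟩
    exact actOn_mul_of ρ x z.1 g.unop
  refine ⟨⟨LinearMap.range φ, hmem⟩,
    ⟨Representation.Equiv.mk (LinearEquiv.ofInjective φ hφ) fun g => ?_⟩⟩
  refine LinearMap.ext fun z => Subtype.ext ?_
  exact actOn_mul_of ρ x z.1 g.unop

/-- Some c·g·c is nonzero, hence so is its factor c·g·(row sum), and the embedding of the ideal
carries this over to `ρ`. -/
theorem exists_actOn_rowSum_ne_zero (h : Appears T ρ) : ∃ x, actOn ρ x (rowSum T) ≠ 0 := by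
  obtain ⟨N, ⟨φ⟩⟩ := h
  obtain ⟨g, hg⟩ := exists_mul_of_mul_ne_zero (youngSymmetrizer_ne_zero T)
  let ψ : (rightIdeal (youngSymmetrizer T)).toSubmodule →ₗ[ℂ] V :=
    N.toSubmodule.subtype.comp φ.toLinearMap
  have hψ : Function.Injective ψ := Subtype.val_injective.comp φ.toLinearEquiv.injective
  have hmem : ∀ y, youngSymmetrizer T * y ∈ (rightIdeal (youngSymmetrizer T)).toSubmodule :=
    fun y => ⟨y, rfl⟩
  have hact : ∀ y k, ψ ⟨youngSymmetrizer T * (y * k), hmem _⟩ =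
      actOn ρ (ψ ⟨youngSymmetrizer T * y, hmem _⟩) k := by
    intro y k
    induction k using MonoidAlgebra.induction_linear with
    | zero =>
      rw [map_zero, ← map_zero ψ]
      congr 1
      exact Subtype.ext (by simp)
    | add k l hk hl =>
      rw [map_add, ← hk, ← hl, ← map_add]
      congr 1
      exact Subtype.ext (by simp [mul_add])
    | single σ c =>
      have hs : MonoidAlgebra.single σ c = c • MonoidAlgebra.of ℂ (Equiv.Perm (Fin n)) σ := by simp
      rw [hs, map_smul, actOn_of]
      have h1 := congrArg Subtype.val
        (φ.toIntertwiningMap.isIntertwining (g := .op σ) (v := ⟨youngSymmetrizer T * y, hmem _⟩))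
      refine Eq.trans ?_ (congrArg (c • ·) h1)
      refine Eq.trans (congrArg ψ ?_) (map_smul ψ c
        ((rightIdeal (youngSymmetrizer T)).toRepresentation (.op σ)
          ⟨youngSymmetrizer T * y, hmem _⟩))
      refine Subtype.ext ?_
      change youngSymmetrizer T * (y * c • MonoidAlgebra.of ℂ _ σ) =
        c • (youngSymmetrizer T * y * MonoidAlgebra.of ℂ _ σ)
      rw [mul_smul_comm, mul_smul_comm, mul_assoc]
  refine ⟨ψ ⟨youngSymmetrizer T * MonoidAlgebra.of ℂ _ g, hmem _⟩, ?_⟩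
  rw [← hact]
  intro h0
  have h1 := congrArg Subtype.val (hψ (h0.trans (map_zero ψ).symm))
  refine hg ?_
  change youngSymmetrizer T * (MonoidAlgebra.of ℂ _ g * rowSum T) = 0 at h1
  rw [← mul_assoc] at h1
  nth_rw 2 [youngSymmetrizer_eq]
  rw [← mul_assoc, h1, zero_mul]

end Young

/-! ### Linear forms in general position -/

/-- A left inverse of the map given by `v` supplies forms dual to the vectors, for which the matrix
is the identity. Forms at places outside the range of `q` are set to 0. -/
theorem exists_forms_det_ne_zero {ι : Type*} [Fintype ι] [DecidableEq ι] {d : ℕ}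
    {v : ι → Fin d → ℂ} (hv : LinearIndependent ℂ v) {q : ι → ℕ} (hq : Function.Injective q) :
    ∃ u : ℕ × Fin d → ℂ, (Matrix.of fun k l => ∑ c, u (q l, c) * v k c).det ≠ 0 := by
  obtain ⟨g, hg⟩ := LinearMap.exists_leftInverse_of_injective (Finsupp.linearCombination ℂ v)
    (LinearMap.ker_eq_bot.mpr hv)
  refine ⟨fun x => Function.extend q (fun l => g (Pi.single x.2 1) l) 0 x.1, ?_⟩
  have h : (Matrix.of fun k l => ∑ c, Function.extend q (fun l => g (Pi.single c 1) l) 0 (q l) *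
      v k c) = (1 : Matrix ι ι ℂ) := by
    ext k l
    simp only [Matrix.of_apply, hq.extend_apply]
    have h1 : v k = ∑ c, v k c • Pi.single c (1 : ℂ) := by
      refine (pi_eq_sum_univ (v k)).trans (Finset.sum_congr rfl fun c _ => ?_)
      congr 1
      funext j
      simp [Pi.single_apply, eq_comm]
    have h2 : g (v k) = Finsupp.single k 1 := by
      have := LinearMap.congr_fun hg (Finsupp.single k 1)
      simpa using this
    have h3 := congrArg (fun z : ι →₀ ℂ => z l) ((congrArg g h1).symm.trans h2)
    simp only [map_sum, map_smul, Finsupp.finsetSum_apply, Finsupp.smul_apply, smul_eq_mul] at h3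
    simp only [mul_comm _ (v k _), h3, Matrix.one_apply, Finsupp.single_apply]
  simp only [h, Matrix.det_one, ne_eq, one_ne_zero, not_false_eq_true]

/-- Finitely many linearly independent families of vectors have nonzero minors with respect to
a common generic choice of linear forms. -/
theorem exists_forms_det_blocks_ne_zero {ι : Type*} [Fintype ι] [DecidableEq ι] {d : ℕ}
    (v : ι → Fin d → ℂ) (b q : ι → ℕ)
    (hv : ∀ i, LinearIndependent ℂ fun k : {k // b k = i} => v k)
    (hq : ∀ k l, b k = b l → q k = q l → k = l) :
    ∃ u : ℕ × Fin d → ℂ,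
      (Matrix.of fun k l => if b k = b l then ∑ c, u (q l, c) * v k c else 0).det ≠ 0 := by
  let P : ℕ → MvPolynomial (ℕ × Fin d) ℂ := fun i => (Matrix.of fun k l : {k // b k = i} =>
    ∑ c, MvPolynomial.X (q l, c) * MvPolynomial.C (v k c)).det
  have hP : ∀ i u, MvPolynomial.eval u (P i) =
      (Matrix.of fun k l : {k // b k = i} => ∑ c, u (q l, c) * v k c).det := by
    intro i u
    rw [RingHom.map_det]
    congr 1
    ext k l
    simp
  -- Each minor is a nonzero polynomial in the coefficients of the forms, hence so is their product.
  -- Over an infinite field some point avoids all their zeros at once.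
  have hne : ∏ i ∈ Finset.univ.image b, P i ≠ 0 := by
    rw [Finset.prod_ne_zero_iff]
    intro i _ h0
    obtain ⟨u, hu⟩ := exists_forms_det_ne_zero (hv i) (q := fun k => q k)
      (fun k l h => Subtype.ext (hq _ _ (k.2.trans l.2.symm) h))
    rw [← hP, h0, map_zero] at hu
    exact hu rfl
  obtain ⟨u, hu⟩ : ∃ u, MvPolynomial.eval u (∏ i ∈ Finset.univ.image b, P i) ≠ 0 := by
    by_contra! h
    exact hne (MvPolynomial.funext fun x => by rw [h, map_zero])
  refine ⟨u, ?_⟩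
  rw [Matrix.BlockTriangular.det (b := b)]
  · rw [map_prod] at hu
    convert hu using 2 with i _
    rw [hP]
    congr 1
    ext k l
    simp [Matrix.toSquareBlock_def, k.2, l.2]
  · intro k l h
    exact if_neg h.ne'

/-! ### The doubly multilinear module -/

section Module

variable {E : Type*} (M : Matroid E) {n : ℕ} (e : Fin n ≃ E)

theorem monomial_val_eq (a : Fin n ≃ E) :
    monomial M a (fun i => (i : ℕ)) = (Equiv.Perm.sign (a.trans e.symm) : ℤ) •
      monomial M e fun i => ((a.trans e.symm)⁻¹ i : ℕ) := by
  rw [← monomial_comp_perm]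
  congr 1
  · funext i
    simp
  · funext i
    exact congrArg Fin.val ((a.trans e.symm).symm_apply_apply i).symm

theorem monomial_val_mem (a : Fin n ≃ E) :
    monomial M a (fun i => (i : ℕ)) ∈ doublyMultilinear M e := by
  rw [monomial_val_eq M e]
  exact Submodule.smul_mem _ _ (Submodule.subset_span ⟨_, rfl⟩)

/-- The element `(a₁|p₁) ⋯ (a_n|p_n)` of `ℂ ⊗ U(M)`, for an ordering `a` of `E`. -/
def orderingTensor (a : Fin n ≃ E) : TensorProduct ℤ ℂ (doublyMultilinear M e) :=
  (1 : ℂ) ⊗ₜ[ℤ] ⟨monomial M a fun i => (i : ℕ), monomial_val_mem M e a⟩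

theorem complexRep_tmul (g : (Equiv.Perm (Fin n))ᵐᵒᵖ) (z : ℂ) (u : doublyMultilinear M e) :
    complexRep M e g (z ⊗ₜ u) =
      z ⊗ₜ ⟨placeRep M n g u, (doublyMultilinearSub M e).apply_mem_toSubmodule g u.2⟩ := rfl

theorem complexRep_orderingTensor (g : Equiv.Perm (Fin n)) (a : Fin n ≃ E) :
    complexRep M e (.op g) (orderingTensor M e a) = orderingTensor M e (g.trans a) := by
  rw [orderingTensor, complexRep_tmul, orderingTensor]
  congr 2
  exact placeRep_monomial M g a

theorem span_orderingTensor :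
    Submodule.span ℂ (Set.range (orderingTensor M e)) = ⊤ := by
  rw [eq_top_iff]
  rintro x -
  induction x using TensorProduct.induction_on with
  | zero => exact Submodule.zero_mem _
  | add x y hx hy => exact Submodule.add_mem _ hx hy
  | tmul z u =>
    rw [← mul_one z, ← smul_eq_mul, ← TensorProduct.smul_tmul']
    refine Submodule.smul_mem _ _ ?_
    obtain ⟨u, hu⟩ := u
    induction hu using Submodule.span_induction with
    | zero =>
      have h0 : (⟨0, Submodule.zero_mem _⟩ : doublyMultilinear M e) = 0 := rfl
      exact (congrArg ((1 : ℂ) ⊗ₜ[ℤ] ·) h0).trans (TensorProduct.tmul_zero _ _) ▸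
        Submodule.zero_mem _
    | add x y hx hy ihx ihy =>
      have h := Submodule.add_mem _ ihx ihy
      rw [← TensorProduct.tmul_add] at h
      exact h
    | smul c x hx ih =>
      have h := Submodule.smul_mem _ (c : ℂ) ih
      have h1 : (c : ℂ) • ((1 : ℂ) ⊗ₜ[ℤ] (⟨x, hx⟩ : doublyMultilinear M e)) =
          (1 : ℂ) ⊗ₜ[ℤ] (c • (⟨x, hx⟩ : doublyMultilinear M e)) := by
        rw [TensorProduct.tmul_smul, Int.cast_smul_eq_zsmul]
      rw [h1] at h
      exact h
    | mem x hx =>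
      obtain ⟨σ, rfl⟩ := hx
      have h1 : (⟨monomial M e fun i => (σ i : ℕ), Submodule.subset_span ⟨σ, rfl⟩⟩ :
          doublyMultilinear M e) = (Equiv.Perm.sign σ : ℤ) •
          ⟨monomial M (σ⁻¹.trans e) fun i => (i : ℕ), monomial_val_mem M e _⟩ := by
        refine Subtype.ext ?_
        change monomial M e (fun i => (σ i : ℕ)) = (Equiv.Perm.sign σ : ℤ) •
          monomial M (σ⁻¹.trans e) fun i => (i : ℕ)
        rw [← monomial_comp_perm]
        congr 1
        funext i
        exact congrArg e (σ.symm_apply_apply i).symm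
      have h2 : (1 : ℂ) ⊗ₜ[ℤ] (⟨monomial M e fun i => (σ i : ℕ),
          Submodule.subset_span ⟨σ, rfl⟩⟩ : doublyMultilinear M e) =
          ((Equiv.Perm.sign σ : ℤ) : ℂ) • orderingTensor M e (σ⁻¹.trans e) := by
        rw [h1, TensorProduct.tmul_smul, Int.cast_smul_eq_zsmul, orderingTensor]
      rw [h2]
      exact Submodule.smul_mem _ _ (Submodule.subset_span ⟨_, rfl⟩)

theorem exists_actOn_orderingTensor_ne_zero {h : MonoidAlgebra ℂ (Equiv.Perm (Fin n))}
    (hx : ∃ x, actOn (complexRep M e) x h ≠ 0) :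
    ∃ a, actOn (complexRep M e) (orderingTensor M e a) h ≠ 0 := by
  by_contra! h0
  obtain ⟨x, hx⟩ := hx
  refine hx ?_
  -- The action of `h` as a linear map in the vector, so that it can be tested on the spanning
  -- orderings.
  let L : TensorProduct ℤ ℂ (doublyMultilinear M e) →ₗ[ℂ]
      TensorProduct ℤ ℂ (doublyMultilinear M e) :=
    ∑ g, h.coeff g • complexRep M e (.op g)
  have hL : ∀ x, L x = actOn (complexRep M e) x h := by
    intro x
    simp [L, actOn, Finsupp.linearCombination_apply, Finsupp.sum_fintype, LinearMap.sum_apply]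
  have hL0 : L = 0 := by
    refine LinearMap.ext_on (span_orderingTensor M e) ?_
    rintro _ ⟨a, rfl⟩
    rw [hL, h0]
    rfl
  rw [← hL, hL0]
  rfl

variable {M}

theorem exists_functional_orderingTensor {V : Type*} [AddCommGroup V] [Module ℂ V] {f : E → V}
    (hf : ∀ I : Set E, M.Indep I ↔ LinearIndepOn ℂ f I) (φ : Fin n → V →ₗ[ℂ] ℂ) :
    ∃ Ψ : TensorProduct ℤ ℂ (doublyMultilinear M e) →ₗ[ℂ] ℂ, ∀ a : Fin n ≃ E,
      Ψ (orderingTensor M e a) = ∏ i, φ i (f (a i)) := by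
  obtain ⟨ψ, hψ⟩ := exists_functional hf φ
  refine ⟨LinearMap.liftBaseChange ℂ (ψ.comp (doublyMultilinear M e).subtype), fun a => ?_⟩
  rw [orderingTensor, LinearMap.liftBaseChange_tmul, one_smul]
  exact hψ a

end Module

/-! ### Rows of tableaux -/

section Rows

variable {lam : YoungDiagram} {n : ℕ} (T : Tableau lam n)

theorem card_rowOf_eq (i : ℕ) :
    (Finset.univ.filter fun k => rowOf T k = i).card = lam.rowLen i := by
  rw [YoungDiagram.rowLen_eq_card]
  refine Finset.card_bij (fun k _ => (T.symm k).1) ?_ ?_ ?_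
  · intro k hk
    rw [Finset.mem_filter] at hk
    exact YoungDiagram.mem_row_iff.mpr ⟨(T.symm k).2, hk.2⟩
  · intro k _ l _ h
    exact T.symm.injective (Subtype.ext h)
  · intro x hx
    rw [YoungDiagram.mem_row_iff] at hx
    exact ⟨T ⟨x, hx.1⟩, Finset.mem_filter.mpr ⟨Finset.mem_univ _, by simpa [rowOf] using hx.2⟩,
      by simp⟩

theorem rowOf_lt (k : Fin n) : rowOf T k < n := by
  have hmem : ∀ i ∈ Finset.range (rowOf T k + 1), (i, 0) ∈ lam.cells := fun i hi =>
    lam.up_left_mem (Nat.lt_succ_iff.mp (Finset.mem_range.mp hi)) (Nat.zero_le _)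
      (mem_of_rowOf_colOf T k)
  have h : (Finset.range (rowOf T k + 1)).card ≤ (Finset.univ : Finset (Fin n)).card := by
    refine Finset.card_le_card_of_injOn
      (fun i => if h : (i, 0) ∈ lam.cells then T ⟨(i, 0), h⟩ else k) (by simp) ?_
    intro i hi j hj h
    simp only [hmem i hi, hmem j hj, dif_pos] at h
    simpa using h
  simpa using h

theorem card_rowOf_lt (m : ℕ) :
    (Finset.univ.filter fun k => rowOf T k < m).card = ∑ i ∈ Finset.range m, lam.rowLen i := by
  rw [Finset.card_eq_sum_card_fiberwise (f := rowOf T) (t := Finset.range m)]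
  · refine Finset.sum_congr rfl fun i hi => ?_
    rw [← card_rowOf_eq T, Finset.filter_filter]
    congr 1
    refine Finset.filter_congr fun k _ => ⟨fun h => h.2, fun h => ⟨?_, h⟩⟩
    rw [h]
    exact Finset.mem_range.mp hi
  · intro k hk
    simpa using hk

end Rows

/-! ### Necessity of the dominance condition -/

section Necessity

variable {E : Type*} {M : Matroid E} {n : ℕ} (e : Fin n ≃ E) {lam : YoungDiagram}
  (T : Tableau lam n)

theorem indep_row_of_actOn_ne_zero (hE : M.E = Set.univ) {a : Fin n ≃ E}
    (ha : actOn (complexRep M e) (orderingTensor M e a) (rowSum T) ≠ 0) (i : ℕ) :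
    M.Indep (a '' {k | rowOf T k = i}) := by
  by_contra hdep
  have hdep : M.Dep (a '' {k | rowOf T k = i}) := ⟨hdep, by simp [hE]⟩
  refine ha ?_
  let t : Fin (Fintype.card {k // rowOf T k = i}) ⊕ Fin (Fintype.card {k // ¬ rowOf T k = i}) ≃
      Fin n :=
    (Equiv.sumCongr (Fintype.equivFin _).symm (Fintype.equivFin _).symm).trans
      (Equiv.sumCompl fun k => rowOf T k = i)
  have htl : ∀ x, t (.inl x) = ((Fintype.equivFin {k // rowOf T k = i}).symm x).1 := fun x => by
    simp [t]
  have htr : ∀ x, t (.inr x) = ((Fintype.equivFin {k // ¬ rowOf T k = i}).symm x).1 :=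
    fun x => by simp [t]
  have hrange : Set.range (a ∘ t ∘ Sum.inl) = a '' {k | rowOf T k = i} := by
    rw [Set.range_comp]
    congr 1
    ext k
    constructor
    · rintro ⟨x, rfl⟩
      exact (congrArg (rowOf T) (htl x)).trans ((Fintype.equivFin {k // rowOf T k = i}).symm x).2
    · intro hk
      exact ⟨Fintype.equivFin _ ⟨k, hk⟩, by simp [htl]⟩
  have hrow : ∀ s, extendPositions t s ∈ rowGroup T := by
    intro s
    rw [mem_rowGroup]
    intro k
    obtain ⟨x | x, rfl⟩ := t.surjective k
    · rw [extendPositions_inl, htl, htl, ((Fintype.equivFin {k // rowOf T k = i}).symm _).2,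
        ((Fintype.equivFin {k // rowOf T k = i}).symm _).2]
    · rw [extendPositions_inr]
  -- The signed sum over the permutations of row `i` alone. The full row sum absorbs it up to a
  -- factorial, while it annihilates the tensor if the row is dependent.
  let y : MonoidAlgebra ℂ (Equiv.Perm (Fin n)) := ∑ s,
    ((Equiv.Perm.sign (extendPositions t s) : ℤ) : ℂ) • MonoidAlgebra.of ℂ _ (extendPositions t s)
  have hy : y * rowSum T = (Fintype.card (Equiv.Perm (Fin (Fintype.card {k // rowOf T k = i}))) :
      ℂ) • rowSum T := by
    simp only [y, Finset.sum_mul, smul_mul_assoc, of_mul_rowSum T (hrow _), smul_smul,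
      sign_mul_self, one_smul]
    simp [← Nat.cast_smul_eq_nsmul ℂ]
  have hy0 : actOn (complexRep M e) (orderingTensor M e a) y = 0 := by
    have h1 : ∀ s, actOn (complexRep M e) (orderingTensor M e a)
        (((Equiv.Perm.sign (extendPositions t s) : ℤ) : ℂ) •
          MonoidAlgebra.of ℂ _ (extendPositions t s)) =
        ((1 : ℂ) ⊗ₜ[ℤ] ((Equiv.Perm.sign (extendPositions t s) : ℤ) •
          ⟨_, monomial_val_mem M e ((extendPositions t s).trans a)⟩ : doublyMultilinear M e)) := by
      intro s
      rw [map_smul, actOn_of, complexRep_orderingTensor, orderingTensor, TensorProduct.tmul_smul,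
        Int.cast_smul_eq_zsmul]
    rw [map_sum, Finset.sum_congr rfl fun s _ => h1 s, ← TensorProduct.tmul_sum]
    refine (congrArg _ (Subtype.ext ?_)).trans (TensorProduct.tmul_zero _ _)
    rw [AddSubmonoidClass.coe_finsetSum, ZeroMemClass.coe_zero,
      ← sum_monomial_extendPositions_eq_zero (c := fun i : Fin n => (i : ℕ)) Fin.val_injective t
        (hrange ▸ hdep), ← Equiv.sum_comp (Equiv.inv _)]
    refine Finset.sum_congr rfl fun s _ => ?_
    change (Equiv.Perm.sign (extendPositions t s⁻¹) : ℤ) •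
      monomial M (a ∘ extendPositions t s⁻¹) (fun i => (i : ℕ)) = _
    -- Permuting letters by s⁻¹ equals, up to sign, permuting places by s. This sign cancels the one
    -- in `y`, leaving the unsigned sum of the Whitney relation.
    have h2 := monomial_comp_perm M a (fun i => (extendPositions t s i : ℕ))
      (extendPositions t s⁻¹)
    have h3 : (fun i => (extendPositions t s i : ℕ)) ∘ extendPositions t s⁻¹ =
        fun i : Fin n => (i : ℕ) := by
      funext i
      rw [← extendPositions_inv]
      exact congrArg Fin.val ((extendPositions t s).apply_symm_apply i)
    rw [h3] at h2
    rw [h2, smul_smul, ← Units.val_mul, Int.units_mul_self, Units.val_one, one_smul]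
  have h := actOn_mul (complexRep M e) (orderingTensor M e a) y (rowSum T)
  rw [hy, hy0, actOn_zero, map_smul] at h
  exact (smul_eq_zero.mp h).resolve_left (Nat.cast_ne_zero.mpr Fintype.card_ne_zero)

theorem dominatedBy_of_indep_rows {a : Fin n ≃ E}
    (ha : ∀ i, M.Indep (a '' {k | rowOf T k = i})) :
    DominatedBy lam.rowLen (rankPartition M) := by
  intro k
  have : Finite E := Finite.of_equiv _ a
  rw [sum_rankPartition]
  refine le_csSup ⟨Nat.card E, ?_⟩ ⟨fun j => a '' {l | rowOf T l = j}, fun j => ha j, ?_⟩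
  · rintro _ ⟨J, -, rfl⟩
    exact Set.ncard_le_card _
  · rw [← card_rowOf_lt T, ← Set.image_iUnion, Set.ncard_image_of_injective _ a.injective,
      ← Set.ncard_coe_finset]
    congr 1
    ext l
    simp only [Finset.coe_filter, Finset.mem_univ, true_and, Set.mem_ofPred_eq, Set.mem_iUnion]
    exact ⟨fun h => ⟨⟨_, h⟩, rfl⟩, fun ⟨j, hj⟩ => hj ▸ j.2⟩

theorem dominatedBy_of_appears (hE : M.E = Set.univ) (h : Appears T (complexRep M e)) :
    DominatedBy lam.rowLen (rankPartition M) := by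
  obtain ⟨a, ha⟩ := exists_actOn_orderingTensor_ne_zero M e (exists_actOn_rowSum_ne_zero T _ h)
  exact dominatedBy_of_indep_rows T (indep_row_of_actOn_ne_zero e T hE ha)

end Necessity

/-! ### Sufficiency of the dominance condition -/

section Sufficiency

variable {E : Type*} {M : Matroid E} {n : ℕ} (e : Fin n ≃ E) {lam : YoungDiagram}
  (T : Tableau lam n)

theorem exists_ordering_indep_rows (e : Fin n ≃ E)
    (hdom : DominatedBy lam.rowLen (rankPartition M)) :
    ∃ a : Fin n ≃ E, ∀ i, M.Indep (a '' {k | rowOf T k = i}) := by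
  classical
  have : Fintype E := Fintype.ofEquiv _ e
  -- Every row index is below `n`, so `n` colours suffice; surplus colours have empty classes.
  have hN : ∑ i ∈ Finset.range n, lam.rowLen i = Fintype.card E := by
    rw [← card_rowOf_lt T, ← Fintype.card_congr e, Finset.filter_true_of_mem]
    · simp
    · exact fun k _ => rowOf_lt T k
  obtain ⟨c, hc⟩ := exists_indep_partition M (fun i j h => lam.rowLen_anti i j h) hN hdom
  have hcard : ∀ i, Fintype.card {k // rowOf T k = i} = Fintype.card {x // (c x : ℕ) = i} := by
    intro i
    rw [Fintype.card_subtype, card_rowOf_eq, Fintype.card_subtype]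
    by_cases hi : i < n
    · have h := (hc ⟨i, hi⟩).2
      rw [← h, ← Set.ncard_coe_finset]
      congr 1
      ext x
      simp [Fin.ext_iff]
    · rw [← card_rowOf_eq T,
        Finset.filter_false_of_mem fun k _ (h : rowOf T k = i) => hi (h ▸ rowOf_lt T k),
        Finset.filter_false_of_mem fun x _ (h : (c x : ℕ) = i) => hi (h ▸ (c x).2)]
      rfl
  let F : ∀ i, {k // rowOf T k = i} ≃ {x // (c x : ℕ) = i} := fun i =>
    Fintype.equivOfCardEq (hcard i)
  refine ⟨Equiv.ofFiberEquiv F, fun i => ?_⟩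
  have hF : ∀ k, (c (Equiv.ofFiberEquiv F k) : ℕ) = rowOf T k := Equiv.ofFiberEquiv_map F
  by_cases hi : i < n
  · refine (hc ⟨i, hi⟩).1.subset ?_
    rintro _ ⟨k, hk, rfl⟩
    exact Fin.ext ((hF k).trans hk)
  · convert M.empty_indep
    rw [Set.image_eq_empty]
    refine Set.eq_empty_of_forall_notMem fun k hk => hi ?_
    rw [← show rowOf T k = i from hk]
    exact rowOf_lt T k

theorem appears_of_indep_rows {d : ℕ} {f : E → Fin d → ℂ}
    (hf : ∀ I : Set E, M.Indep I ↔ LinearIndepOn ℂ f I) {a : Fin n ≃ E}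
    (ha : ∀ i, M.Indep (a '' {k | rowOf T k = i})) : Appears T (complexRep M e) := by
  obtain ⟨u, hu⟩ := exists_forms_det_blocks_ne_zero (fun k => f (a k)) (rowOf T) (colOf T)
    (fun i => by
      have h := (hf _).mp (ha i)
      exact h.comp_of_image a.injective.injOn)
    (fun k l => eq_of_rowOf_eq_of_colOf_eq T)
  let φ : ℕ → (Fin d → ℂ) →ₗ[ℂ] ℂ := fun j =>
    ∑ c, u (j, c) • (LinearMap.proj c : (Fin d → ℂ) →ₗ[ℂ] ℂ)
  have hφ : ∀ j x, φ j x = ∑ c, u (j, c) * x c := by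
    intro j x
    simp [φ, LinearMap.sum_apply]
  obtain ⟨Ψ, hΨ⟩ := exists_functional_orderingTensor e hf fun k => φ (colOf T k)
  refine appears_of_actOn_ne_zero T _ (x := orderingTensor M e a) fun h0 => ?_
  have hterm : ∀ r, ∀ c ∈ colGroup T,
      Ψ (actOn (complexRep M e) (orderingTensor M e a)
        (((Equiv.Perm.sign r : ℤ) : ℂ) • MonoidAlgebra.of ℂ _ r * MonoidAlgebra.of ℂ _ c)) =
      ((Equiv.Perm.sign r : ℤ) : ℂ) * ∏ k, φ (colOf T k) (f (a (r k))) := by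
    intro r c hc
    rw [smul_mul_assoc, ← map_mul, map_smul, map_smul, actOn_of, complexRep_orderingTensor, hΨ,
      smul_eq_mul]
    congr 1
    -- The forms depend only on the column, so reindexing by `c` removes it from the product.
    rw [← Equiv.prod_comp c (fun k => φ (colOf T k) (f (a (r k))))]
    refine Finset.prod_congr rfl fun k _ => ?_
    rw [(mem_colGroup T).mp hc]
    rfl
  have hdet : ∑ r ∈ rowGroup T,
      ((Equiv.Perm.sign r : ℤ) : ℂ) * ∏ k, φ (colOf T k) (f (a (r k))) ≠ 0 := by
    -- In the Leibniz expansion of the block matrix, exactly the terms of permutations outside the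
    -- row group contain a forced zero entry.
    convert hu
    rw [Matrix.det_apply', rowGroup, Finset.sum_filter]
    refine Finset.sum_congr rfl fun σ _ => ?_
    split_ifs with h
    · congr 1
      refine Finset.prod_congr rfl fun k _ => ?_
      rw [hφ]
      exact (if_pos (h k)).symm
    · push Not at h
      obtain ⟨k, hk⟩ := h
      rw [Finset.prod_eq_zero (Finset.mem_univ k), mul_zero]
      exact if_neg hk
  have h1 := congrArg Ψ h0
  rw [youngSymmetrizer, Finset.sum_mul_sum, map_sum, map_sum, map_zero,
    Finset.sum_congr rfl (g := fun r => ((colGroup T).card : ℂ) *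
      (((Equiv.Perm.sign r : ℤ) : ℂ) * ∏ k, φ (colOf T k) (f (a (r k))))),
    ← Finset.mul_sum] at h1
  · refine mul_ne_zero (Nat.cast_ne_zero.mpr ?_) hdet h1
    exact Finset.card_ne_zero_of_mem ((mem_colGroup T).mpr fun k => rfl : (1 : Equiv.Perm (Fin n)) ∈ _)
  · intro r _
    rw [map_sum, map_sum, Finset.sum_congr rfl (hterm r), Finset.sum_const, nsmul_eq_mul]

end Sufficiency

end Whitney

end

theorem mainTheorem4 {E : Type*} (M : Matroid E) (hE : M.E = Set.univ)
    (hM : Whitney.RealizableOverComplex M) {n : ℕ} (e : Fin n ≃ E)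
    (lam : YoungDiagram) (T : Whitney.Tableau lam n) :
    Whitney.Appears T (Whitney.complexRep M e) ↔
      Whitney.DominatedBy lam.rowLen (Whitney.rankPartition M) := by
  refine ⟨Whitney.dominatedBy_of_appears e T hE, fun h => ?_⟩
  obtain ⟨d, f, hf⟩ := hM
  obtain ⟨a, ha⟩ := Whitney.exists_ordering_indep_rows T e h
  exact Whitney.appears_of_indep_rows e T hf ha
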